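/- Let $N,M$ be natural numbers, $\sigma>0$, $\lambda>0$, antenna positions $\mathbf t_1,\dots,\mathbf t_N\in\mathbb R^2$, angles $\theta_m,\varphi_m\in\mathbb R$, Rician factors $K_m\ge 0$ and path losses $\beta_m>0$ ($m=1,\dots,M$). Put $\boldsymbol\rho_m=(\sin\theta_m\cos\varphi_m,\cos\theta_m)^{\mathrm T}$ and let $\mathbf G\in\mathbb C^{N\times M}$ be the line-of-sight channel, $[\mathbf G]_{n,m}=e^{\mathrm i\frac{2\pi}{\lambda}\mathbf t_n^{\mathrm T}\boldsymbol\rho_m}$. Let $\mathbf\Lambda=\mathrm{diag}\big(\tfrac{K_m\beta_m}{K_m+1}\big)$ and $\mathbf D=\mathrm{diag}\big(\tfrac{M\beta_m}{K_m+1}\big)$. For a precoder $\mathbf F\in\mathbb C^{N\times M}$ with columns $\mathbf f_1,\dots,\mathbf f_M$ let $\mathbf B=\mathbf\Lambda^{1/2}\mathbf G^{\mathrm H}\mathbf F$ and $\widetilde{\mathbf D}=\mathrm{diag}(\|\mathbf f_n\|^2,\ n=1,\dots,M)$. For every $\mathbf F\neq 0$ there is a unique pair $\delta,\tilde\delta>0$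 with $$\delta=\tfrac1M\mathrm{tr}(\mathbf D\mathbf\Gamma),\qquad \tilde\delta=\tfrac1M\mathrm{tr}(\widetilde{\mathbf D}\widetilde{\mathbf\Gamma}),$$ where $\mathbf\Phi=(\mathbf I+\tilde\delta\mathbf D)^{-1}$, $\widetilde{\mathbf\Phi}=(\mathbf I+\delta\widetilde{\mathbf D})^{-1}$, $\mathbf\Gamma=(\sigma^2\mathbf\Phi^{-1}+\mathbf B\widetilde{\mathbf\Phi}\mathbf B^{\mathrm H})^{-1}$, $\widetilde{\mathbf\Gamma}=(\sigma^2\widetilde{\mathbf\Phi}^{-1}+\mathbf B^{\mathrm H}\mathbf\Phi\mathbf B)^{-1}$. Let also $\mathbf\Xi=\mathbf B\widetilde{\mathbf\Phi}\mathbf B^{\mathrm H}$, $\widetilde{\mathbf\Xi}=\mathbf B^{\mathrm H}\mathbf\Phi\mathbf B$, and let the deterministic equivalent of the eavesdropper rate be $$\overline{\mathcal R}_e(\mathbf F)=-\log|\sigma^2\mathbf\Gamma|+\log|\mathbf I+\delta\widetilde{\mathbf D}|-\sigma^2M\delta\tilde\delta .$$ At every $\mathbf F\ne0$, the quantities $\delta,\tilde\delta,\mathbf\Phi,\widetilde{\mathbf\Phi},\mathbf\Xi,\widetilde{\mathbf\Xi},\mathbf\Gamma,\widetilde{\mathbf\Gamma},\overline{\mathcal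 R}_e$ are real differentiable functions of $\mathbf F$. Fix $1\le i\le N$, $1\le j\le M$ and let a subscript $(i,j)$ together with a prime denote the Wirtinger derivative $\partial/\partial F_{(i,j)}^*=\tfrac12\big(\partial/\partial\Re F_{(i,j)}+\mathrm i\,\partial/\partial\Im F_{(i,j)}\big)$. Then, with $\hat\delta$ the Kronecker delta, $$\widetilde{\mathbf D}'_{(i,j)}=\mathrm{diag}\big(F_{(i,j)}\hat\delta(n,j),\ n=1,\dots,M\big),$$ and the derivatives of $\delta,\tilde\delta$ satisfy the linear fixed-point system $$\delta'_{(i,j)}=\tfrac1M\mathrm{tr}\big(\mathbf D\mathbf\Gamma'_{(i,j)}\big),\qquad \tilde\delta'_{(i,j)}=\tfrac1M\mathrm{tr}\big(\widetilde{\mathbf D}\widetilde{\mathbf\Gamma}'_{(i,j)}\big)+\tfrac1M\mathrm{tr}\big(\widetilde{\mathbf D}'_{(i,j)}\widetilde{\mathbf\Gamma}\big),$$ where $$\mathbf\Xi'_{(i,j)}=\mathbf B\widetilde{\mathbf\Phi}\mathbf e_j\mathbf e_i^{\mathrm T}\mathbf G\mathbf\Lambda^{1/2}+\mathbf B\widetilde{\mathbf\Phi}'_{(i,j)}\mathbf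 B^{\mathrm H},\qquad \widetilde{\mathbf\Xi}'_{(i,j)}=\mathbf e_j\mathbf e_i^{\mathrm T}\mathbf G\mathbf\Lambda^{1/2}\mathbf\Phi\mathbf B+\mathbf B^{\mathrm H}\mathbf\Phi'_{(i,j)}\mathbf B,$$ $$\mathbf\Gamma'_{(i,j)}=-\mathbf\Gamma\big(\sigma^2\tilde\delta'_{(i,j)}\mathbf D+\mathbf\Xi'_{(i,j)}\big)\mathbf\Gamma,\qquad \widetilde{\mathbf\Gamma}'_{(i,j)}=-\widetilde{\mathbf\Gamma}\big(\sigma^2\delta\widetilde{\mathbf D}'_{(i,j)}+\sigma^2\delta'_{(i,j)}\widetilde{\mathbf D}+\widetilde{\mathbf\Xi}'_{(i,j)}\big)\widetilde{\mathbf\Gamma},$$ $$\mathbf\Phi'_{(i,j)}=-\mathbf\Phi\big(\tilde\delta'_{(i,j)}\mathbf D\big)\mathbf\Phi,\qquad \widetilde{\mathbf\Phi}'_{(i,j)}=-\widetilde{\mathbf\Phi}\big(\delta\widetilde{\mathbf D}'_{(i,j)}+\delta'_{(i,j)}\widetilde{\mathbf D}\big)\widetilde{\mathbf\Phi}.$$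 The gradient $\boldsymbol\nabla_{e,\mathbf F}$ of $\overline{\mathcal R}_e$, whose $(i,j)$ entry is $\partial\overline{\mathcal R}_e/\partial F_{(i,j)}^*$, is given by $$[\boldsymbol\nabla_{e,\mathbf F}]_{(i,j)}=-\mathrm{tr}\big(\mathbf\Gamma^{-1}\mathbf\Gamma'_{(i,j)}\big)+\mathrm{tr}\big[\widetilde{\mathbf\Phi}\big(\delta\widetilde{\mathbf D}'_{(i,j)}+\delta'_{(i,j)}\widetilde{\mathbf D}\big)\big]-\sigma^2M\big(\delta'_{(i,j)}\tilde\delta+\delta\tilde\delta'_{(i,j)}\big).$$ -/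

import Mathlib

open scoped Matrix

noncomputable section

/-- The conjugate Wirtinger derivative `∂f/∂X*_(i,j) = (∂f/∂(Re X_(i,j)) + I ∂f/∂(Im X_(i,j))) / 2`
at the point `X` of a complex valued function `f` of a complex `N × M` matrix. -/
def wirtingerConj {N M : ℕ} (f : Matrix (Fin N) (Fin M) ℂ → ℂ) (X : Matrix (Fin N) (Fin M) ℂ)
    (i : Fin N) (j : Fin M) : ℂ :=
  (1 / 2) * (deriv (fun s : ℝ => f (X + Matrix.single i j (s : ℂ))) 0 +
    Complex.I * deriv (fun s : ℝ => f (X + Matrix.single i j ((s : ℂ) * Complex.I))) 0)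

/-- The conjugate Wirtinger derivative of a matrix valued function, taken entry by entry. -/
def wirtingerConjMat {N M p q : ℕ} (f : Matrix (Fin N) (Fin M) ℂ → Matrix (Fin p) (Fin q) ℂ)
    (X : Matrix (Fin N) (Fin M) ℂ) (i : Fin N) (j : Fin M) : Matrix (Fin p) (Fin q) ℂ :=
  Matrix.of fun a b => wirtingerConj (fun Y => f Y a b) X i j

/-- The parameters of the Rician channel from `N` movable transmit antennas to `M` cooperating
single-antenna eavesdroppers. -/
structure EveChannel (N M : ℕ) where
  /-- position `t_n` of the `n`th antenna in the plane -/
  pos : Fin N → Fin 2 → ℝ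
  /-- the wavelength -/
  wavelength : ℝ
  /-- elevation angles of the line-of-sight paths -/
  theta : Fin M → ℝ
  /-- azimuth angles of the line-of-sight paths -/
  phi : Fin M → ℝ
  /-- Rician factors -/
  K : Fin M → ℝ
  /-- path losses -/
  beta : Fin M → ℝ
  /-- noise standard deviation -/
  sigma : ℝ
  wavelength_pos : 0 < wavelength
  K_nonneg : ∀ m, 0 ≤ K m
  beta_pos : ∀ m, 0 < beta m
  sigma_pos : 0 < sigma

namespace EveChannel

variable {N M : ℕ} (S : EveChannel N M)

/-- The direction vector of the line-of-sight path to the `m`th eavesdropper. -/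
def rho (m : Fin M) : Fin 2 → ℝ :=
  ![Real.sin (S.theta m) * Real.cos (S.phi m), Real.cos (S.theta m)]

/-- The `N × M` line-of-sight channel; its `m`th column is the field-response vector of the
`m`th eavesdropper. -/
def GLoS : Matrix (Fin N) (Fin M) ℂ :=
  Matrix.of fun n m =>
    Complex.exp (Complex.I * ((2 * Real.pi / S.wavelength * (S.pos n ⬝ᵥ S.rho m) : ℝ) : ℂ))

/-- The square root of `Λ = diag (K_m β_m / (K_m + 1))`. -/
def sqrtLambda : Matrix (Fin M) (Fin M) ℂ :=
  Matrix.diagonal fun m => ((Real.sqrt (S.K m * S.beta m / (S.K m + 1)) : ℝ) : ℂ)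

/-- `B = Λ^(1/2) G_LoSᴴ F`. -/
def B (F : Matrix (Fin N) (Fin M) ℂ) : Matrix (Fin M) (Fin M) ℂ :=
  S.sqrtLambda * S.GLoSᴴ * F

/-- `D = diag (M β_m / (K_m + 1))`. -/
def D : Matrix (Fin M) (Fin M) ℂ :=
  Matrix.diagonal fun m => (((M : ℝ) * S.beta m / (S.K m + 1) : ℝ) : ℂ)

/-- `D̃ = diag (‖f_n‖²)`, where `f_n` is the `n`th column of `F`. -/
def Dt (F : Matrix (Fin N) (Fin M) ℂ) : Matrix (Fin M) (Fin M) ℂ :=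
  Matrix.diagonal fun n => ((∑ k, ‖F k n‖ ^ 2 : ℝ) : ℂ)

/-- `Φ = (I + y D)⁻¹`, for a candidate value `y` of `δ̃`. -/
def PhiAt (y : ℝ) : Matrix (Fin M) (Fin M) ℂ :=
  (1 + (y : ℂ) • S.D)⁻¹

/-- `Φ̃ = (I + x D̃)⁻¹`, for a candidate value `x` of `δ`. -/
def PhitAt (F : Matrix (Fin N) (Fin M) ℂ) (x : ℝ) : Matrix (Fin M) (Fin M) ℂ :=
  (1 + (x : ℂ) • Dt F)⁻¹

/-- `Γ = (σ² Φ⁻¹ + B Φ̃ Bᴴ)⁻¹`, for a candidate pair `(x, y)`. -/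
def GammaAt (F : Matrix (Fin N) (Fin M) ℂ) (x y : ℝ) : Matrix (Fin M) (Fin M) ℂ :=
  ((S.sigma : ℂ) ^ 2 • (S.PhiAt y)⁻¹ + S.B F * PhitAt F x * (S.B F)ᴴ)⁻¹

/-- `Γ̃ = (σ² Φ̃⁻¹ + Bᴴ Φ B)⁻¹`, for a candidate pair `(x, y)`. -/
def GammatAt (F : Matrix (Fin N) (Fin M) ℂ) (x y : ℝ) : Matrix (Fin M) (Fin M) ℂ :=
  ((S.sigma : ℂ) ^ 2 • (PhitAt F x)⁻¹ + (S.B F)ᴴ * S.PhiAt y * S.B F)⁻¹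

/-- `p = (δ, δ̃)` is a positive solution of the fixed-point system
`δ = tr (D Γ) / M`, `δ̃ = tr (D̃ Γ̃) / M`. -/
def IsPosSol (F : Matrix (Fin N) (Fin M) ℂ) (p : ℝ × ℝ) : Prop :=
  0 < p.1 ∧ 0 < p.2 ∧
  (p.1 : ℂ) = 1 / (M : ℂ) * (S.D * S.GammaAt F p.1 p.2).trace ∧
  (p.2 : ℂ) = 1 / (M : ℂ) * (Dt F * S.GammatAt F p.1 p.2).trace

open scoped Classical in
/-- The positive solution `(δ, δ̃)` of the fixed-point system (and `0` where there is none,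
as for `F = 0`). -/
def sol (F : Matrix (Fin N) (Fin M) ℂ) : ℝ × ℝ :=
  if h : ∃ p, S.IsPosSol F p then h.choose else 0

/-- `δ` as a function of the precoder. -/
def delta (F : Matrix (Fin N) (Fin M) ℂ) : ℝ := (S.sol F).1

/-- `δ̃` as a function of the precoder. -/
def deltat (F : Matrix (Fin N) (Fin M) ℂ) : ℝ := (S.sol F).2

/-- `Φ` as a function of the precoder. -/
def Phi (F : Matrix (Fin N) (Fin M) ℂ) : Matrix (Fin M) (Fin M) ℂ := S.PhiAt (S.deltat F)

/-- `Φ̃` as a function of the precoder. -/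
def Phit (F : Matrix (Fin N) (Fin M) ℂ) : Matrix (Fin M) (Fin M) ℂ := PhitAt F (S.delta F)

/-- `Γ` as a function of the precoder. -/
def Gamma (F : Matrix (Fin N) (Fin M) ℂ) : Matrix (Fin M) (Fin M) ℂ :=
  S.GammaAt F (S.delta F) (S.deltat F)

/-- `Γ̃` as a function of the precoder. -/
def Gammat (F : Matrix (Fin N) (Fin M) ℂ) : Matrix (Fin M) (Fin M) ℂ :=
  S.GammatAt F (S.delta F) (S.deltat F)

/-- `Ξ = B Φ̃ Bᴴ` as a function of the precoder. -/
def Xi (F : Matrix (Fin N) (Fin M) ℂ) : Matrix (Fin M) (Fin M) ℂ :=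
  S.B F * S.Phit F * (S.B F)ᴴ

/-- `Ξ̃ = Bᴴ Φ B` as a function of the precoder. -/
def Xit (F : Matrix (Fin N) (Fin M) ℂ) : Matrix (Fin M) (Fin M) ℂ :=
  (S.B F)ᴴ * S.Phi F * S.B F

/-- The deterministic equivalent of the eavesdropper rate,
`- log |σ² Γ| + log |I + δ D̃| - σ² M δ δ̃` (both determinants are positive real numbers). -/
def rate (F : Matrix (Fin N) (Fin M) ℂ) : ℝ :=
  - Real.log (((S.sigma : ℂ) ^ 2 • S.Gamma F).det.re)
    + Real.log ((1 + (S.delta F : ℂ) • Dt F).det.re)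
    - S.sigma ^ 2 * (M : ℝ) * S.delta F * S.deltat F

/-- The gradient of the rate with respect to the precoder: the matrix whose `(i,j)` entry is
`∂ rate / ∂ F*_(i,j)`. -/
def rateGradient (F : Matrix (Fin N) (Fin M) ℂ) : Matrix (Fin N) (Fin M) ℂ :=
  Matrix.of fun i j => wirtingerConj (fun X => (S.rate X : ℂ)) F i j

end EveChannel

end

/-! Write `f x y` for the normalized trace of `diag d` against the inverse of `covar s d t B x y`.
The two equations for `(δ, δ̃)` read `x = f x y` and `y = g y x`, where `g` is the same function
with `d` and `t` exchanged and `B` replaced by `Bᴴ`. Everything about this system rests on one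
scaling inequality, `normTrace_lt_mul`: for `α > 1`, if `x ≤ α x₀` and `y₀ ≤ α y` then `f x y < α f
x₀ y₀`. It follows from strict antitonicity of the inverse in the Loewner order.

Letting `α` decrease to 1, `f` is increasing in `x` and decreasing in `y`, so the system is a
monotone self-map of a box whose second side carries the reversed order, and Knaster–Tarski gives a
solution. For two solutions, take `α` to be the largest ratio of corresponding coordinates, in
either direction: `α > 1` would make every ratio strictly smaller than `α`. Hence uniqueness.

The infinitesimal form of the inequality, `normTrace_partials_lt`, says that the Jacobian of the
system at a solution is strictly diagonally dominant after weighting by the solution itself, hence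
invertible. The implicit function theorem gives a differentiable local family of solutions, which by
uniqueness is `(δ, δ̃)`. Every other quantity is then differentiable, being built from `δ`, `δ̃` and
the precoder by sums, products, inverses and logarithms of positive determinants.

The formulas come from a calculus of conjugate Wirtinger derivatives (`HasConjDeriv`): complex
linear maps, products, inverses and `log det` obey the usual rules, `F` has derivative 0 and `Fᴴ`
has derivative `e_j e_iᵀ`. As differentiability is known beforehand, differentiating the mutually
dependent definitions is not circular. -/

noncomputable section

open scoped ComplexOrder
open Matrix Topology Filter

/-! ### Positive definite matrices and antitonicity of the inverse. -/

namespace Matrix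

variable {ι : Type*}

theorem PosDef.re_diag_pos {A : Matrix ι ι ℂ} (hA : A.PosDef) (i : ι) : 0 < (A i i).re :=
  (Complex.lt_def.1 (hA.diag_pos (i := i))).1

theorem PosSemidef.re_diag_nonneg {A : Matrix ι ι ℂ} (hA : A.PosSemidef) (i : ι) :
    0 ≤ (A i i).re :=
  (Complex.le_def.1 (hA.diag_nonneg (i := i))).1

variable [DecidableEq ι]

theorem posSemidef_diagonal_ofReal {v : ι → ℝ} (hv : ∀ i, 0 ≤ v i) :
    (diagonal fun i => (v i : ℂ)).PosSemidef :=
  PosSemidef.diagonal fun i => by simpa using hv i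

theorem posDef_diagonal_ofReal {v : ι → ℝ} (hv : ∀ i, 0 < v i) :
    (diagonal fun i => (v i : ℂ)).PosDef :=
  PosDef.diagonal fun i => by simpa using hv i

variable [Fintype ι]

/-- For Hermitian `A` and `B` both summands are congruences, of `A - B` and of `B⁻¹`, so
antitonicity of the inverse, strict or not, is visible without square roots. -/
theorem inv_sub_inv_eq_add {A B : Matrix ι ι ℂ} (hA : IsUnit A) (hB : IsUnit B) :
    B⁻¹ - A⁻¹ = A⁻¹ * (A - B) * A⁻¹ + (A⁻¹ * (A - B)) * B⁻¹ * ((A - B) * A⁻¹) := by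
  have h1 : A⁻¹ * A = 1 := Matrix.nonsing_inv_mul _ ((Matrix.isUnit_iff_isUnit_det _).1 hA)
  have h2 : A * A⁻¹ = 1 := Matrix.mul_nonsing_inv _ ((Matrix.isUnit_iff_isUnit_det _).1 hA)
  have h3 : B⁻¹ * B = 1 := Matrix.nonsing_inv_mul _ ((Matrix.isUnit_iff_isUnit_det _).1 hB)
  have h4 : B * B⁻¹ = 1 := Matrix.mul_nonsing_inv _ ((Matrix.isUnit_iff_isUnit_det _).1 hB)
  have e1 : A⁻¹ * (A - B) = 1 - A⁻¹ * B := by rw [mul_sub, h1]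
  have e2 : (A - B) * A⁻¹ = 1 - B * A⁻¹ := by rw [sub_mul, h2]
  rw [e1, e2]
  have e3 : (1 - A⁻¹ * B) * B⁻¹ = B⁻¹ - A⁻¹ := by
    rw [sub_mul, one_mul, mul_assoc, h4, mul_one]
  rw [e3, mul_sub, mul_one, sub_mul B⁻¹, ← mul_assoc B⁻¹, h3, sub_mul, one_mul, mul_assoc]
  abel

theorem PosDef.inv_sub_inv_posSemidef {A B : Matrix ι ι ℂ} (hA : A.PosDef) (hB : B.PosDef)
    (h : (A - B).PosSemidef) : (B⁻¹ - A⁻¹).PosSemidef := by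
  rw [inv_sub_inv_eq_add hA.isUnit hB.isUnit]
  have hH : (A⁻¹)ᴴ = A⁻¹ := hA.inv.isHermitian
  have hC : (A - B)ᴴ = A - B := h.isHermitian
  refine PosSemidef.add ?_ ?_
  · simpa [hH] using h.mul_mul_conjTranspose_same A⁻¹
  · have := hB.inv.posSemidef.mul_mul_conjTranspose_same (A⁻¹ * (A - B))
    rwa [conjTranspose_mul, hH, hC] at this

theorem PosDef.inv_sub_inv_posDef {A B : Matrix ι ι ℂ} (hA : A.PosDef) (hB : B.PosDef)
    (h : (A - B).PosDef) : (B⁻¹ - A⁻¹).PosDef := by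
  rw [inv_sub_inv_eq_add hA.isUnit hB.isUnit]
  have hH : (A⁻¹)ᴴ = A⁻¹ := hA.inv.isHermitian
  have hC : (A - B)ᴴ = A - B := h.isHermitian
  refine PosDef.add_posSemidef ?_ ?_
  · have := h.mul_mul_conjTranspose_same (B := A⁻¹)
      (vecMul_injective_of_isUnit hA.inv.isUnit)
    rwa [hH] at this
  · have := hB.inv.posSemidef.mul_mul_conjTranspose_same (A⁻¹ * (A - B))
    rwa [conjTranspose_mul, hH, hC] at this

end Matrix

/-! ### The coupled fixed-point system: scaling, existence, uniqueness. -/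

section Resolvent

variable {M : ℕ}

/-- The matrix `s (I + y diag d) + B (I + x diag t)⁻¹ Bᴴ`. -/
def covar (s : ℝ) (d t : Fin M → ℝ) (B : Matrix (Fin M) (Fin M) ℂ) (x y : ℝ) :
    Matrix (Fin M) (Fin M) ℂ :=
  diagonal (fun m => ((s * (1 + y * d m) : ℝ) : ℂ)) +
    B * diagonal (fun n => (((1 + x * t n)⁻¹ : ℝ) : ℂ)) * Bᴴ

/-- The normalized trace of `diag d` times the inverse of `covar s d t B x y`. -/
def normTrace (s : ℝ) (d t : Fin M → ℝ) (B : Matrix (Fin M) (Fin M) ℂ) (x y : ℝ) : ℝ :=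
  1 / (M : ℝ) * ∑ m, d m * (((covar s d t B x y)⁻¹ m m).re)

variable {s : ℝ} {d t : Fin M → ℝ} {B : Matrix (Fin M) (Fin M) ℂ} {x y x₀ y₀ α : ℝ}

theorem covar_posDef (hs : 0 < s) (hd : ∀ m, 0 ≤ d m) (ht : ∀ m, 0 ≤ t m) (hx : 0 ≤ x)
    (hy : 0 ≤ y) : (covar s d t B x y).PosDef := by
  refine PosDef.add_posSemidef (posDef_diagonal_ofReal fun m => ?_) ?_
  · have := mul_nonneg hy (hd m); positivity
  · refine PosSemidef.mul_mul_conjTranspose_same (posSemidef_diagonal_ofReal fun m => ?_) _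
    have := mul_nonneg hx (ht m); positivity

theorem covar_sub (s : ℝ) (d t : Fin M → ℝ) (B : Matrix (Fin M) (Fin M) ℂ) (x y x₀ y₀ α : ℝ) :
    (α : ℂ) • covar s d t B x y - covar s d t B x₀ y₀ =
      diagonal (fun m => ((α * (s * (1 + y * d m)) - s * (1 + y₀ * d m) : ℝ) : ℂ)) +
      B * diagonal (fun n => ((α * (1 + x * t n)⁻¹ - (1 + x₀ * t n)⁻¹ : ℝ) : ℂ)) * Bᴴ := by
  have h1 : (diagonal (fun n => ((α * (1 + x * t n)⁻¹ - (1 + x₀ * t n)⁻¹ : ℝ) : ℂ)) :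
      Matrix (Fin M) (Fin M) ℂ) = (α : ℂ) • diagonal (fun n => (((1 + x * t n)⁻¹ : ℝ) : ℂ))
        - diagonal (fun n => (((1 + x₀ * t n)⁻¹ : ℝ) : ℂ)) := by
    rw [← diagonal_smul, diagonal_sub]
    congr 1; ext n; simp
  have h2 : (diagonal (fun m => ((α * (s * (1 + y * d m)) - s * (1 + y₀ * d m) : ℝ) : ℂ)) :
      Matrix (Fin M) (Fin M) ℂ) = (α : ℂ) • diagonal (fun m => ((s * (1 + y * d m) : ℝ) : ℂ))
        - diagonal (fun m => ((s * (1 + y₀ * d m) : ℝ) : ℂ)) := by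
    rw [← diagonal_smul, diagonal_sub]
    congr 1; ext n; simp
  rw [h1, h2, covar, covar, mul_sub, sub_mul, smul_add, mul_smul_comm, smul_mul_assoc]
  abel

/-- The difference `α • covar x y - covar x₀ y₀` is positive definite: its diagonal part is at least
`s (α - 1) > 0`, and its middle factor is nonnegative because `1 + x t ≤ α (1 + x₀ t)`. Inverting
reverses the order and moves `α` to the other side. -/
theorem re_inv_covar_lt (hs : 0 < s) (hd : ∀ m, 0 ≤ d m) (ht : ∀ m, 0 ≤ t m) (hx : 0 ≤ x)
    (hy : 0 ≤ y) (hx₀ : 0 ≤ x₀) (hy₀ : 0 ≤ y₀) (hα : 1 < α) (h1 : x ≤ α * x₀)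
    (h2 : y₀ ≤ α * y) (m : Fin M) :
    ((covar s d t B x y)⁻¹ m m).re < α * ((covar s d t B x₀ y₀)⁻¹ m m).re := by
  have hα0 : (0 : ℝ) < α := by linarith
  have hA := covar_posDef (B := B) hs hd ht hx hy
  have hB := covar_posDef (B := B) hs hd ht hx₀ hy₀
  have hα' : (0 : ℂ) < (α : ℂ) := by exact_mod_cast hα0
  have hA' : ((α : ℂ) • covar s d t B x y).PosDef := hA.smul hα'
  have hdiff : ((α : ℂ) • covar s d t B x y - covar s d t B x₀ y₀).PosDef := by
    rw [covar_sub]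
    refine PosDef.add_posSemidef (posDef_diagonal_ofReal fun m => ?_) ?_
    · have := mul_le_mul_of_nonneg_right h2 (hd m)
      have h3 : 0 < α * (1 + y * d m) - (1 + y₀ * d m) := by nlinarith
      have := mul_pos hs h3
      linarith
    · refine PosSemidef.mul_mul_conjTranspose_same (posSemidef_diagonal_ofReal fun n => ?_) _
      have a1 := mul_nonneg hx (ht n)
      have a2 := mul_nonneg hx₀ (ht n)
      have a3 := mul_le_mul_of_nonneg_right h1 (ht n)
      rw [sub_nonneg, ← div_eq_mul_inv, inv_eq_one_div, div_le_div_iff₀ (by positivity)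
        (by positivity)]
      nlinarith
  have := (hA'.inv_sub_inv_posDef hB hdiff).re_diag_pos m
  have e : ((α : ℂ) • covar s d t B x y)⁻¹ = ((α⁻¹ : ℝ) : ℂ) • (covar s d t B x y)⁻¹ := by
    rw [Matrix.inv_eq_right_inv]
    rw [smul_mul_smul_comm, Matrix.mul_nonsing_inv _ ((Matrix.isUnit_iff_isUnit_det _).1 hA.isUnit)]
    rw [← Complex.ofReal_mul, mul_inv_cancel₀ hα0.ne']; simp
  rw [e] at this
  simp only [Matrix.sub_apply, Matrix.smul_apply, smul_eq_mul, Complex.sub_re,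
    Complex.re_ofReal_mul, sub_pos] at this
  rwa [inv_mul_lt_iff₀ hα0] at this

theorem sum_mul_lt_sum_mul {d a b : Fin M → ℝ} (hd : ∀ m, 0 ≤ d m) (hd0 : ∃ m, 0 < d m)
    (h : ∀ m, a m < b m) : ∑ m, d m * a m < ∑ m, d m * b m := by
  obtain ⟨m, hm⟩ := hd0
  exact Finset.sum_lt_sum (fun i _ => mul_le_mul_of_nonneg_left (h i).le (hd i))
    ⟨m, Finset.mem_univ _, mul_lt_mul_of_pos_left (h m) hm⟩

theorem natCast_pos_of_exists {d : Fin M → ℝ} (hd0 : ∃ m, 0 < d m) : (0 : ℝ) < M := by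
  obtain ⟨m, -⟩ := hd0
  exact_mod_cast m.pos

theorem normTrace_lt_mul (hs : 0 < s) (hd : ∀ m, 0 ≤ d m) (hd0 : ∃ m, 0 < d m)
    (ht : ∀ m, 0 ≤ t m) (hx : 0 ≤ x) (hy : 0 ≤ y) (hx₀ : 0 ≤ x₀) (hy₀ : 0 ≤ y₀) (hα : 1 < α)
    (h1 : x ≤ α * x₀) (h2 : y₀ ≤ α * y) :
    normTrace s d t B x y < α * normTrace s d t B x₀ y₀ := by
  have hM := natCast_pos_of_exists hd0
  have := sum_mul_lt_sum_mul hd hd0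
    (fun m => re_inv_covar_lt (B := B) hs hd ht hx hy hx₀ hy₀ hα h1 h2 m)
  rw [normTrace, normTrace, mul_left_comm, Finset.mul_sum (a := α)]
  refine mul_lt_mul_of_pos_left ?_ (by positivity)
  simpa only [mul_left_comm] using this

theorem normTrace_pos (hs : 0 < s) (hd : ∀ m, 0 ≤ d m) (hd0 : ∃ m, 0 < d m)
    (ht : ∀ m, 0 ≤ t m) (hx : 0 ≤ x) (hy : 0 ≤ y) : 0 < normTrace s d t B x y := by
  have hM := natCast_pos_of_exists hd0
  have := sum_mul_lt_sum_mul hd hd0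
    (fun m => (covar_posDef (B := B) hs hd ht hx hy).inv.re_diag_pos m)
  simp only [mul_zero, Finset.sum_const_zero] at this
  rw [normTrace]; positivity

theorem normTrace_mono (hs : 0 < s) (hd : ∀ m, 0 ≤ d m) (hd0 : ∃ m, 0 < d m)
    (ht : ∀ m, 0 ≤ t m) (hx : 0 ≤ x) (hy₀ : 0 ≤ y₀) (h1 : x ≤ x₀) (h2 : y₀ ≤ y) :
    normTrace s d t B x y ≤ normTrace s d t B x₀ y₀ := by
  have hp := normTrace_pos (B := B) hs hd hd0 ht (hx.trans h1) hy₀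
  -- The limit `α → 1` of the scaling inequality: any `c` above the right-hand value is `α` times
  -- that value for some `α > 1`.
  refine le_of_forall_gt_imp_ge_of_dense fun c hc => ?_
  have hα : 1 < c / normTrace s d t B x₀ y₀ := by rwa [one_lt_div hp]
  have := normTrace_lt_mul (B := B) hs hd hd0 ht hx (hy₀.trans h2) (hx.trans h1) hy₀ hα
    (by nlinarith) (by nlinarith)
  rw [div_mul_cancel₀ _ hp.ne'] at this
  exact this.le

/-- `covar` dominates `s` times the identity, so its inverse is at most `s⁻¹`. This bounds the box
for the fixed-point argument. -/
theorem normTrace_le (hs : 0 < s) (hd : ∀ m, 0 ≤ d m) (ht : ∀ m, 0 ≤ t m) (hx : 0 ≤ x)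
    (hy : 0 ≤ y) : normTrace s d t B x y ≤ 1 / (M : ℝ) * ∑ m, d m * s⁻¹ := by
  refine mul_le_mul_of_nonneg_left (Finset.sum_le_sum fun m _ =>
    mul_le_mul_of_nonneg_left ?_ (hd m)) (by positivity)
  have hA := covar_posDef (B := B) hs hd ht hx hy
  have hB : (diagonal fun _ : Fin M => (s : ℂ)).PosDef := posDef_diagonal_ofReal fun _ => hs
  have hdiff : (covar s d t B x y - diagonal fun _ : Fin M => (s : ℂ)).PosSemidef := by
    have : covar s d t B x y - (diagonal fun _ : Fin M => (s : ℂ)) =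
        diagonal (fun m => ((s * (y * d m) : ℝ) : ℂ)) +
        B * diagonal (fun n => (((1 + x * t n)⁻¹ : ℝ) : ℂ)) * Bᴴ := by
      rw [covar, add_sub_right_comm, diagonal_sub]
      congr 2; ext n; push_cast; ring
    rw [this]
    refine PosSemidef.add (posSemidef_diagonal_ofReal fun m => ?_) ?_
    · have := mul_nonneg hy (hd m); positivity
    · refine PosSemidef.mul_mul_conjTranspose_same (posSemidef_diagonal_ofReal fun m => ?_) _
      have := mul_nonneg hx (ht m); positivity
  have := (hA.inv_sub_inv_posSemidef hB hdiff).re_diag_nonneg m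
  have e : (diagonal fun _ : Fin M => (s : ℂ))⁻¹ = diagonal fun _ : Fin M => ((s⁻¹ : ℝ) : ℂ) := by
    rw [Matrix.inv_eq_right_inv]
    rw [diagonal_mul_diagonal]
    rw [← Complex.ofReal_mul, mul_inv_cancel₀ hs.ne']; simp
  rw [e] at this
  simpa using this

/-- The coupled positive fixed-point system of the two normalized traces has a solution. -/
theorem exists_normTrace_fixedPoint (hs : 0 < s) (hd : ∀ m, 0 ≤ d m) (hd0 : ∃ m, 0 < d m)
    (ht : ∀ m, 0 ≤ t m) (ht0 : ∃ m, 0 < t m) :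
    ∃ x y : ℝ, 0 < x ∧ 0 < y ∧ x = normTrace s d t B x y ∧ y = normTrace s t d Bᴴ y x := by
  set b := 1 / (M : ℝ) * ∑ m, d m * s⁻¹ with hb
  set c := 1 / (M : ℝ) * ∑ m, t m * s⁻¹ with hc
  have hfb : ∀ {x y : ℝ}, 0 ≤ x → 0 ≤ y → normTrace s d t B x y ≤ b :=
    fun hx hy => normTrace_le hs hd ht hx hy
  have hgc : ∀ {x y : ℝ}, 0 ≤ x → 0 ≤ y → normTrace s t d Bᴴ y x ≤ c :=
    fun hx hy => normTrace_le hs ht hd hy hx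
  have hfp : ∀ {x y : ℝ}, 0 ≤ x → 0 ≤ y → 0 < normTrace s d t B x y :=
    fun hx hy => normTrace_pos hs hd hd0 ht hx hy
  have hgp : ∀ {x y : ℝ}, 0 ≤ x → 0 ≤ y → 0 < normTrace s t d Bᴴ y x :=
    fun hx hy => normTrace_pos hs ht ht0 hd hy hx
  have hb0 : 0 ≤ b := (hfp le_rfl le_rfl).le.trans (hfb le_rfl le_rfl)
  have hc0 : 0 ≤ c := (hgp le_rfl le_rfl).le.trans (hgc le_rfl le_rfl)
  -- By monotonicity the smallest values on the box occur at corners: first argument 0, second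
  -- argument at its upper bound.
  set a := normTrace s d t B 0 c with ha
  set e := normTrace s t d Bᴴ 0 b with he
  have ha0 : 0 < a := hfp le_rfl hc0
  have he0 : 0 < e := hgp hb0 le_rfl
  have hab : a ≤ b := hfb le_rfl hc0
  have hec : e ≤ c := hgc hb0 le_rfl
  have hfa : ∀ {x y : ℝ}, 0 ≤ x → 0 ≤ y → y ≤ c → a ≤ normTrace s d t B x y :=
    fun hx hy h => normTrace_mono hs hd hd0 ht le_rfl hy hx h
  have hge : ∀ {x y : ℝ}, 0 ≤ x → 0 ≤ y → x ≤ b → e ≤ normTrace s t d Bᴴ y x :=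
    fun hx hy h => normTrace_mono hs ht ht0 hd le_rfl hx hy h
  let : Fact (a ≤ b) := ⟨hab⟩
  let : Fact (e ≤ c) := ⟨hec⟩
  -- Reversing the order of the second interval makes the mixed-monotone map monotone on a complete
  -- lattice, so it has a least fixed point; no continuity is needed.
  let T : (Set.Icc a b × (Set.Icc e c)ᵒᵈ) →o (Set.Icc a b × (Set.Icc e c)ᵒᵈ) :=
    { toFun := fun p =>
        have hx : 0 ≤ p.1.1 := ha0.le.trans p.1.2.1
        have hy : 0 ≤ (OrderDual.ofDual p.2).1 := he0.le.trans (OrderDual.ofDual p.2).2.1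
        (⟨normTrace s d t B p.1.1 (OrderDual.ofDual p.2).1,
          hfa hx hy (OrderDual.ofDual p.2).2.2, hfb hx hy⟩,
         OrderDual.toDual ⟨normTrace s t d Bᴴ (OrderDual.ofDual p.2).1 p.1.1,
          hge hx hy p.1.2.2, hgc hx hy⟩)
      monotone' := by
        intro p p' hpp
        have h1 : p.1.1 ≤ p'.1.1 := hpp.1
        have h2 : (OrderDual.ofDual p'.2).1 ≤ (OrderDual.ofDual p.2).1 := hpp.2
        have hx : 0 ≤ p.1.1 := ha0.le.trans p.1.2.1
        have hy : 0 ≤ (OrderDual.ofDual p'.2).1 := he0.le.trans (OrderDual.ofDual p'.2).2.1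
        exact ⟨normTrace_mono hs hd hd0 ht hx hy h1 h2, normTrace_mono hs ht ht0 hd hy hx h2 h1⟩ }
  have hfix := T.map_lfp
  set p := T.lfp with hp
  have h1 := congrArg (fun q => q.1.1) hfix
  have h2 := congrArg (fun q => (OrderDual.ofDual q.2).1) hfix
  exact ⟨p.1.1, (OrderDual.ofDual p.2).1, ha0.trans_le p.1.2.1,
    he0.trans_le (OrderDual.ofDual p.2).2.1, h1.symm, h2.symm⟩

/-- The coupled positive fixed-point system of the two normalized traces has at most one
solution. -/
theorem normTrace_fixedPoint_unique (hs : 0 < s) (hd : ∀ m, 0 ≤ d m) (hd0 : ∃ m, 0 < d m)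
    (ht : ∀ m, 0 ≤ t m) (ht0 : ∃ m, 0 < t m) (hx : 0 < x) (hy : 0 < y) (hx₀ : 0 < x₀)
    (hy₀ : 0 < y₀) (h1 : x = normTrace s d t B x y) (h2 : y = normTrace s t d Bᴴ y x)
    (h3 : x₀ = normTrace s d t B x₀ y₀) (h4 : y₀ = normTrace s t d Bᴴ y₀ x₀) :
    x = x₀ ∧ y = y₀ := by
  set α := max (max (x / x₀) (x₀ / x)) (max (y / y₀) (y₀ / y)) with hα
  have b1 : x ≤ α * x₀ := by
    rw [← div_le_iff₀ hx₀]; exact (le_max_left _ _).trans (le_max_left _ _)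
  have b2 : x₀ ≤ α * x := by
    rw [← div_le_iff₀ hx]; exact (le_max_right _ _).trans (le_max_left _ _)
  have b3 : y ≤ α * y₀ := by
    rw [← div_le_iff₀ hy₀]; exact (le_max_left _ _).trans (le_max_right _ _)
  have b4 : y₀ ≤ α * y := by
    rw [← div_le_iff₀ hy]; exact (le_max_right _ _).trans (le_max_right _ _)
  have hα1 : α ≤ 1 := by
    by_contra! hgt
    have c1 : x < α * x₀ := by
      have := normTrace_lt_mul (B := B) hs hd hd0 ht hx.le hy.le hx₀.le hy₀.le hgt b1 b4
      rwa [← h1, ← h3] at this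
    have c2 : x₀ < α * x := by
      have := normTrace_lt_mul (B := B) hs hd hd0 ht hx₀.le hy₀.le hx.le hy.le hgt b2 b3
      rwa [← h1, ← h3] at this
    have c3 : y < α * y₀ := by
      have := normTrace_lt_mul (B := Bᴴ) hs ht ht0 hd hy.le hx.le hy₀.le hx₀.le hgt b3 b2
      rwa [← h2, ← h4] at this
    have c4 : y₀ < α * y := by
      have := normTrace_lt_mul (B := Bᴴ) hs ht ht0 hd hy₀.le hx₀.le hy.le hx.le hgt b4 b1
      rwa [← h2, ← h4] at this
    -- All four ratios are now strictly below `α`, which is their maximum.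
    rw [← div_lt_iff₀ (by assumption)] at c1 c2 c3 c4
    exact absurd hα.symm (max_lt (max_lt c1 c2) (max_lt c3 c4)).ne
  constructor <;> apply le_antisymm <;> nlinarith

end Resolvent

/-! ### Partial derivatives of the system and the implicit function theorem. -/

section Smooth

attribute [local instance] Matrix.linftyOpNormedAddCommGroup Matrix.linftyOpNormedSpace
  Matrix.linftyOpNormedRing Matrix.linftyOpNormedAlgebra

variable {M : ℕ}

/-- The diagonal matrix of a real vector, as a continuous linear map. -/
def diagonalCLM (M : ℕ) : (Fin M → ℝ) →L[ℝ] Matrix (Fin M) (Fin M) ℂ :=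
  LinearMap.toContinuousLinearMap
    { toFun := fun v => diagonal fun i => (v i : ℂ)
      map_add' := fun v w => by rw [diagonal_add]; simp
      map_smul' := fun c v => by
        rw [RingHom.id_apply, ← diagonal_smul]; congr 1; ext i; simp }

/-- The conjugate transpose, as a real continuous linear map. -/
def conjTransposeCLM (N M : ℕ) :
    Matrix (Fin N) (Fin M) ℂ →L[ℝ] Matrix (Fin M) (Fin N) ℂ :=
  LinearMap.toContinuousLinearMap
    { toFun := fun A => Aᴴ
      map_add' := conjTranspose_add
      map_smul' := fun c A => by simp }

/-- A matrix entry, as a complex continuous linear map. -/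
def entryCLM {N M : ℕ} (i : Fin N) (j : Fin M) : Matrix (Fin N) (Fin M) ℂ →L[ℂ] ℂ :=
  LinearMap.toContinuousLinearMap (entryLinearMap ℂ ℂ i j)

/-- The local operator-norm instances make square matrices a complete normed algebra, where
inversion is smooth at units. -/
theorem contDiffAt_matrix_inv {A : Matrix (Fin M) (Fin M) ℂ} (hA : IsUnit A) :
    ContDiffAt ℝ 1 (fun X : Matrix (Fin M) (Fin M) ℂ => X⁻¹) A := by
  obtain ⟨u, rfl⟩ := hA
  simpa only [nonsing_inv_eq_ringInverse] using contDiffAt_ringInverse ℝ u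

theorem HasDerivAt.matrix_inv {A : ℝ → Matrix (Fin M) (Fin M) ℂ} {A' : Matrix (Fin M) (Fin M) ℂ}
    {x : ℝ} (h : HasDerivAt A A' x) (hu : IsUnit (A x)) :
    HasDerivAt (fun r => (A r)⁻¹) (-((A x)⁻¹ * A' * (A x)⁻¹)) x := by
  obtain ⟨u, hu⟩ := hu
  have h1 := hasFDerivAt_ringInverse (𝕜 := ℝ) u
  rw [hu] at h1
  have h2 := h1.comp_hasDerivAt x h
  have e : (↑u⁻¹ : Matrix (Fin M) (Fin M) ℂ) = (A x)⁻¹ := by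
    rw [← hu, nonsing_inv_eq_ringInverse, Ring.inverse_unit]
  simp only [nonsing_inv_eq_ringInverse] at e ⊢
  rw [← e]
  exact h2.congr_deriv (by simp)

theorem HasDerivAt.diagonal_ofReal {v : ℝ → Fin M → ℝ} {v' : Fin M → ℝ} {x : ℝ}
    (h : ∀ n, HasDerivAt (fun r => v r n) (v' n) x) :
    HasDerivAt (fun r => (diagonal fun n => (v r n : ℂ) : Matrix (Fin M) (Fin M) ℂ))
      (diagonal fun n => (v' n : ℂ)) x :=
  (diagonalCLM M).hasFDerivAt.comp_hasDerivAt x (hasDerivAt_pi.2 h)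

variable {s : ℝ} {d t : Fin M → ℝ} {B : Matrix (Fin M) (Fin M) ℂ} {x y : ℝ}

/-- The partial derivative of `normTrace` in its first scalar argument. -/
def normTraceFst (s : ℝ) (d t : Fin M → ℝ) (B : Matrix (Fin M) (Fin M) ℂ) (x y : ℝ) : ℝ :=
  1 / (M : ℝ) * ∑ m, d m * (((covar s d t B x y)⁻¹ *
    (B * diagonal (fun n => ((t n * ((1 + x * t n) ^ 2)⁻¹ : ℝ) : ℂ)) * Bᴴ) *
    (covar s d t B x y)⁻¹) m m).re

/-- The opposite of the partial derivative of `normTrace` in its second scalar argument. -/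
def normTraceSnd (s : ℝ) (d t : Fin M → ℝ) (B : Matrix (Fin M) (Fin M) ℂ) (x y : ℝ) : ℝ :=
  1 / (M : ℝ) * ∑ m, d m * (((covar s d t B x y)⁻¹ *
    diagonal (fun n => ((s * d n : ℝ) : ℂ)) * (covar s d t B x y)⁻¹) m m).re

theorem hasDerivAt_normTrace {c : ℝ → Matrix (Fin M) (Fin M) ℂ} {c' : Matrix (Fin M) (Fin M) ℂ}
    {r : ℝ} (d : Fin M → ℝ) (h : HasDerivAt c c' r) (hu : IsUnit (c r)) :
    HasDerivAt (fun r => 1 / (M : ℝ) * ∑ m, d m * (((c r)⁻¹ m m).re))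
      (-(1 / (M : ℝ) * ∑ m, d m * (((c r)⁻¹ * c' * (c r)⁻¹) m m).re)) r := by
  rw [← mul_neg, ← Finset.sum_neg_distrib]
  refine HasDerivAt.const_mul _ (HasDerivAt.fun_sum fun m _ => ?_)
  rw [← mul_neg]
  refine HasDerivAt.const_mul _ ?_
  have h1 := (Complex.reCLM ∘L (entryCLM m m).restrictScalars ℝ).hasFDerivAt.comp_hasDerivAt r
    (h.matrix_inv hu)
  exact h1

theorem hasDerivAt_normTrace_fst (hs : 0 < s) (hd : ∀ m, 0 ≤ d m) (ht : ∀ m, 0 ≤ t m)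
    (hx : 0 ≤ x) (hy : 0 ≤ y) :
    HasDerivAt (fun r => normTrace s d t B r y) (normTraceFst s d t B x y) x := by
  have h : HasDerivAt (fun r => covar s d t B r y)
      (-(B * diagonal (fun n => ((t n * ((1 + x * t n) ^ 2)⁻¹ : ℝ) : ℂ)) * Bᴴ)) x := by
    have h1 : HasDerivAt (fun r : ℝ => (diagonal fun n => (((1 + r * t n)⁻¹ : ℝ) : ℂ) :
        Matrix (Fin M) (Fin M) ℂ)) (diagonal fun n => ((-(t n * ((1 + x * t n) ^ 2)⁻¹) : ℝ) : ℂ))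
        x := by
      refine HasDerivAt.diagonal_ofReal fun n => ?_
      have h2 : HasDerivAt (fun r : ℝ => 1 + r * t n) (t n) x := by
        simpa using ((hasDerivAt_id x).mul_const (t n)).const_add 1
      have h3 : 1 + x * t n ≠ 0 := by have := mul_nonneg hx (ht n); positivity
      exact (h2.inv h3).congr_deriv (by rw [div_eq_mul_inv, neg_mul])
    have h4 := ((h1.const_mul B).mul_const Bᴴ).const_add
      (diagonal (fun m => ((s * (1 + y * d m) : ℝ) : ℂ)))
    refine h4.congr_deriv ?_
    rw [← neg_mul, ← mul_neg, diagonal_neg]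
    congr 3; ext n; simp
  refine (hasDerivAt_normTrace d h (covar_posDef hs hd ht hx hy).isUnit).congr_deriv ?_
  simp [normTraceFst]

theorem hasDerivAt_normTrace_snd (hs : 0 < s) (hd : ∀ m, 0 ≤ d m) (ht : ∀ m, 0 ≤ t m)
    (hx : 0 ≤ x) (hy : 0 ≤ y) :
    HasDerivAt (fun r => normTrace s d t B x r) (-normTraceSnd s d t B x y) y := by
  have h : HasDerivAt (fun r => covar s d t B x r)
      (diagonal (fun n => ((s * d n : ℝ) : ℂ))) y := by
    refine HasDerivAt.add_const _ (HasDerivAt.diagonal_ofReal fun n => ?_)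
    simpa using (((hasDerivAt_id y).mul_const (d n)).const_add 1).const_mul s
  exact hasDerivAt_normTrace d h (covar_posDef hs hd ht hx hy).isUnit

theorem normTraceSnd_nonneg (hs : 0 < s) (hd : ∀ m, 0 ≤ d m) (ht : ∀ m, 0 ≤ t m)
    (hx : 0 ≤ x) (hy : 0 ≤ y) : 0 ≤ normTraceSnd s d t B x y := by
  refine mul_nonneg (by positivity) (Finset.sum_nonneg fun m _ => mul_nonneg (hd m) ?_)
  refine PosSemidef.re_diag_nonneg ?_ m
  have h1 : (diagonal (fun n => ((s * d n : ℝ) : ℂ)) : Matrix (Fin M) (Fin M) ℂ).PosSemidef :=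
    posSemidef_diagonal_ofReal fun m => mul_nonneg hs.le (hd m)
  have hH : ((covar s d t B x y)⁻¹)ᴴ = (covar s d t B x y)⁻¹ :=
    (covar_posDef hs hd ht hx hy).inv.isHermitian
  simpa only [hH] using h1.mul_mul_conjTranspose_same (covar s d t B x y)⁻¹

/-- The infinitesimal form of `normTrace_lt_mul`. -/
theorem normTrace_partials_lt (hs : 0 < s) (hd : ∀ m, 0 ≤ d m) (hd0 : ∃ m, 0 < d m)
    (ht : ∀ m, 0 ≤ t m) (hx : 0 ≤ x) (hy : 0 ≤ y) :
    x * normTraceFst s d t B x y + y * normTraceSnd s d t B x y < normTrace s d t B x y := by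
  have hM := natCast_pos_of_exists hd0
  have hA := covar_posDef (B := B) hs hd ht hx hy
  set A := covar s d t B x y with hAdef
  have hu := (Matrix.isUnit_iff_isUnit_det _).1 hA.isUnit
  set P := B * diagonal (fun n => ((t n * ((1 + x * t n) ^ 2)⁻¹ : ℝ) : ℂ)) * Bᴴ with hP
  set Q : Matrix (Fin M) (Fin M) ℂ := diagonal (fun n => ((s * d n : ℝ) : ℂ)) with hQ
  -- Removing `y Q` leaves `s` on the diagonal, and `1/(1+xt) - xt/(1+xt)² = 1/(1+xt)²`. The
  -- remainder is thus positive definite, and congruence by `A⁻¹` turns this into the claimed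
  -- inequality on diagonal entries.
  have key : A - (x : ℂ) • P - (y : ℂ) • Q = diagonal (fun _ => (s : ℂ)) +
      B * diagonal (fun n => ((((1 + x * t n) ^ 2)⁻¹ : ℝ) : ℂ)) * Bᴴ := by
    have e1 : (diagonal (fun n => ((((1 + x * t n) ^ 2)⁻¹ : ℝ) : ℂ)) : Matrix (Fin M) (Fin M) ℂ) =
        diagonal (fun n => (((1 + x * t n)⁻¹ : ℝ) : ℂ)) -
          (x : ℂ) • diagonal (fun n => ((t n * ((1 + x * t n) ^ 2)⁻¹ : ℝ) : ℂ)) := by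
      rw [← diagonal_smul, diagonal_sub]
      congr 1; ext n
      have h3 : 1 + x * t n ≠ 0 := by have := mul_nonneg hx (ht n); positivity
      simp only [Pi.smul_apply, smul_eq_mul, ← Complex.ofReal_mul, ← Complex.ofReal_sub]
      congr 1
      field_simp
      ring
    have e2 : (diagonal (fun _ => (s : ℂ)) : Matrix (Fin M) (Fin M) ℂ) =
        diagonal (fun m => ((s * (1 + y * d m) : ℝ) : ℂ)) - (y : ℂ) • Q := by
      rw [hQ, ← diagonal_smul, diagonal_sub]
      congr 1; ext n
      simp only [Pi.smul_apply, smul_eq_mul]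
      push_cast; ring
    rw [e1, e2, hAdef, covar, hP, mul_sub, sub_mul, mul_smul_comm, smul_mul_assoc]
    abel
  have hpd : (A - (x : ℂ) • P - (y : ℂ) • Q).PosDef := by
    rw [key]
    refine PosDef.add_posSemidef (posDef_diagonal_ofReal fun _ => hs)
      (PosSemidef.mul_mul_conjTranspose_same (posSemidef_diagonal_ofReal fun m => ?_) _)
    positivity
  have hpd2 := hpd.mul_mul_conjTranspose_same (B := A⁻¹)
      (vecMul_injective_of_isUnit hA.inv.isUnit)
  have hH : (A⁻¹)ᴴ = A⁻¹ := hA.inv.isHermitian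
  have e3 : A⁻¹ * (A - (x : ℂ) • P - (y : ℂ) • Q) * A⁻¹ =
      A⁻¹ - (x : ℂ) • (A⁻¹ * P * A⁻¹) - (y : ℂ) • (A⁻¹ * Q * A⁻¹) := by
    simp only [mul_sub, sub_mul, mul_smul_comm, smul_mul_assoc, nonsing_inv_mul _ hu, one_mul]
  rw [hH, e3] at hpd2
  have hlt : ∀ m, x * ((A⁻¹ * P * A⁻¹) m m).re + y * ((A⁻¹ * Q * A⁻¹) m m).re < (A⁻¹ m m).re := by
    intro m
    have := hpd2.re_diag_pos m
    simp only [Matrix.sub_apply, Matrix.smul_apply, smul_eq_mul, Complex.sub_re,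
      Complex.re_ofReal_mul] at this
    linarith
  have := mul_lt_mul_of_pos_left (sum_mul_lt_sum_mul hd hd0 hlt)
    (by positivity : 0 < 1 / (M : ℝ))
  refine lt_of_eq_of_lt ?_ this
  simp only [normTraceFst, normTraceSnd, mul_add, Finset.sum_add_distrib, ← hAdef, ← hP, ← hQ]
  congr 1 <;> rw [mul_left_comm, Finset.mul_sum] <;> simp only [mul_left_comm]

variable {E : Type*} [NormedAddCommGroup E] [NormedSpace ℝ E]

theorem ContDiffAt.normTrace {s : ℝ} {d t : E → Fin M → ℝ} {B : E → Matrix (Fin M) (Fin M) ℂ}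
    {x y : E → ℝ} {p : E} (hd : ContDiffAt ℝ 1 d p) (ht : ContDiffAt ℝ 1 t p)
    (hB : ContDiffAt ℝ 1 B p) (hx : ContDiffAt ℝ 1 x p) (hy : ContDiffAt ℝ 1 y p)
    (hs : 0 < s) (hd0 : ∀ m, 0 ≤ d p m) (ht0 : ∀ m, 0 ≤ t p m) (hx0 : 0 ≤ x p) (hy0 : 0 ≤ y p) :
    ContDiffAt ℝ 1 (fun p => normTrace s (d p) (t p) (B p) (x p) (y p)) p := by
  have hd' := contDiffAt_pi.1 hd
  have ht' := contDiffAt_pi.1 ht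
  have hc : ContDiffAt ℝ 1 (fun p => covar s (d p) (t p) (B p) (x p) (y p)) p := by
    refine ContDiffAt.add ?_ (ContDiffAt.mul (ContDiffAt.mul hB ?_) ?_)
    · refine (diagonalCLM M).contDiff.contDiffAt.comp p (contDiffAt_pi.2 fun m => ?_)
      exact contDiffAt_const.mul (contDiffAt_const.add (hy.mul (hd' m)))
    · refine (diagonalCLM M).contDiff.contDiffAt.comp p (contDiffAt_pi.2 fun m => ?_)
      refine ContDiffAt.inv (contDiffAt_const.add (hx.mul (ht' m))) ?_
      have := mul_nonneg hx0 (ht0 m); positivity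
    · exact (conjTransposeCLM M M).contDiff.contDiffAt.comp p hB
  have hi := (contDiffAt_matrix_inv (covar_posDef hs hd0 ht0 hx0 hy0).isUnit).comp p hc
  refine contDiffAt_const.mul (ContDiffAt.sum fun m _ => (hd' m).mul ?_)
  exact (Complex.reCLM ∘L (entryCLM m m).restrictScalars ℝ).contDiff.contDiffAt.comp p hi

/-- A positive solution of the coupled fixed-point system extends to a differentiable family of
solutions when the data vary smoothly. -/
theorem exists_differentiableAt_fixedPoint [CompleteSpace E] {s x₀ y₀ : ℝ} {d : Fin M → ℝ}
    {t : E → Fin M → ℝ} {B : E → Matrix (Fin M) (Fin M) ℂ} {X : E} (ht : ContDiffAt ℝ 1 t X)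
    (hB : ContDiffAt ℝ 1 B X) (hs : 0 < s) (hd : ∀ m, 0 ≤ d m) (hd0 : ∃ m, 0 < d m)
    (ht0 : ∀ m, 0 ≤ t X m) (ht1 : ∃ m, 0 < t X m) (hx : 0 < x₀) (hy : 0 < y₀)
    (h1 : x₀ = normTrace s d (t X) (B X) x₀ y₀) (h2 : y₀ = normTrace s (t X) d (B X)ᴴ y₀ x₀) :
    ∃ φ : E → ℝ × ℝ, DifferentiableAt ℝ φ X ∧ φ X = (x₀, y₀) ∧
      ∀ᶠ Z in 𝓝 X, (φ Z).1 = normTrace s d (t Z) (B Z) (φ Z).1 (φ Z).2 ∧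
        (φ Z).2 = normTrace s (t Z) d (B Z)ᴴ (φ Z).2 (φ Z).1 := by
  let G : E × (ℝ × ℝ) → ℝ × ℝ := fun q =>
    (q.2.1 - normTrace s d (t q.1) (B q.1) q.2.1 q.2.2,
      q.2.2 - normTrace s (t q.1) d (B q.1)ᴴ q.2.2 q.2.1)
  set u : E × (ℝ × ℝ) := (X, (x₀, y₀)) with hu
  have hG0 : G u = 0 := by
    simp only [G, hu, ← h1, ← h2, sub_self]; rfl
  have cx : ContDiffAt ℝ 1 (fun q : E × (ℝ × ℝ) => q.2.1) u := by fun_prop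
  have cy : ContDiffAt ℝ 1 (fun q : E × (ℝ × ℝ) => q.2.2) u := by fun_prop
  have ct : ContDiffAt ℝ 1 (fun q : E × (ℝ × ℝ) => t q.1) u := ht.comp u contDiffAt_fst
  have cB : ContDiffAt ℝ 1 (fun q : E × (ℝ × ℝ) => B q.1) u := hB.comp u contDiffAt_fst
  have cBH : ContDiffAt ℝ 1 (fun q : E × (ℝ × ℝ) => (B q.1)ᴴ) u :=
    (conjTransposeCLM M M).contDiff.contDiffAt.comp u cB
  have cG : ContDiffAt ℝ 1 G u :=
    (cx.sub (ContDiffAt.normTrace contDiffAt_const ct cB cx cy hs hd ht0 hx.le hy.le)).prodMk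
      (cy.sub (ContDiffAt.normTrace ct contDiffAt_const cBH cy cx hs ht0 hd hy.le hx.le))
  have dG := cG.hasStrictFDerivAt one_ne_zero
  set G' := fderiv ℝ G u with hG'
  set a := normTraceFst s d (t X) (B X) x₀ y₀ with ha
  set b := normTraceSnd s d (t X) (B X) x₀ y₀ with hb
  set e := normTraceFst s (t X) d (B X)ᴴ y₀ x₀ with he
  set c := normTraceSnd s (t X) d (B X)ᴴ y₀ x₀ with hc
  -- The columns of the Jacobian are computed along coordinate lines. The off-diagonal entries `b`,
  -- `c` enter with a plus sign because `normTraceSnd` is the opposite of a partial derivative.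
  have g1 : G' (0, (1, 0)) = (1 - a, c) := by
    have l : HasDerivAt (fun r : ℝ => ((X, (r, y₀)) : E × (ℝ × ℝ))) (0, (1, 0)) x₀ :=
      (hasDerivAt_const _ _).prodMk ((hasDerivAt_id _).prodMk (hasDerivAt_const _ _))
    have k1 : HasDerivAt (fun r : ℝ => G (X, (r, y₀))) (G' (0, (1, 0))) x₀ :=
      dG.hasFDerivAt.comp_hasDerivAt x₀ l
    have k2 : HasDerivAt (fun r : ℝ => r - normTrace s d (t X) (B X) r y₀) (1 - a) x₀ :=
      (hasDerivAt_id' x₀).sub (hasDerivAt_normTrace_fst hs hd ht0 hx.le hy.le)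
    have k3 : HasDerivAt (fun r : ℝ => y₀ - normTrace s (t X) d (B X)ᴴ y₀ r) c x₀ := by
      simpa using (hasDerivAt_normTrace_snd (B := (B X)ᴴ) hs ht0 hd hy.le hx.le).const_sub y₀
    exact k1.unique (k2.prodMk k3)
  have g2 : G' (0, (0, 1)) = (b, 1 - e) := by
    have l : HasDerivAt (fun r : ℝ => ((X, (x₀, r)) : E × (ℝ × ℝ))) (0, (0, 1)) y₀ :=
      (hasDerivAt_const _ _).prodMk ((hasDerivAt_const _ _).prodMk (hasDerivAt_id _))
    have k1 : HasDerivAt (fun r : ℝ => G (X, (x₀, r))) (G' (0, (0, 1))) y₀ :=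
      dG.hasFDerivAt.comp_hasDerivAt y₀ l
    have k2 : HasDerivAt (fun r : ℝ => x₀ - normTrace s d (t X) (B X) x₀ r) b y₀ := by
      simpa using (hasDerivAt_normTrace_snd (B := B X) hs hd ht0 hx.le hy.le).const_sub x₀
    have k3 : HasDerivAt (fun r : ℝ => r - normTrace s (t X) d (B X)ᴴ r x₀) (1 - e) y₀ :=
      (hasDerivAt_id' y₀).sub (hasDerivAt_normTrace_fst hs ht0 hd hy.le hx.le)
    exact k1.unique (k2.prodMk k3)
  have ineq1 : x₀ * a + y₀ * b < x₀ := by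
    have := normTrace_partials_lt (B := B X) hs hd hd0 ht0 hx.le hy.le
    rwa [← h1] at this
  have ineq2 : y₀ * e + x₀ * c < y₀ := by
    have := normTrace_partials_lt (B := (B X)ᴴ) hs ht0 ht1 hd hy.le hx.le
    rwa [← h2] at this
  have hb0 : 0 ≤ b := normTraceSnd_nonneg hs hd ht0 hx.le hy.le
  have hc0 : 0 ≤ c := normTraceSnd_nonneg hs ht0 hd hy.le hx.le
  -- Weighted diagonal dominance: at a solution the inequalities become `y₀ b < x₀ (1 - a)` and `x₀
  -- c < y₀ (1 - e)`, with nonnegative left sides, so they can be multiplied and `x₀ y₀` cancelled.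
  have hdet : 0 < (1 - a) * (1 - e) - b * c := by
    have i1 : y₀ * b < x₀ * (1 - a) := by linarith
    have i2 : x₀ * c < y₀ * (1 - e) := by linarith
    have i3 : (y₀ * b) * (x₀ * c) < (x₀ * (1 - a)) * (y₀ * (1 - e)) :=
      mul_lt_mul'' i1 i2 (by positivity) (by positivity)
    have i4 : 0 < (x₀ * y₀) * ((1 - a) * (1 - e) - b * c) := by linarith
    exact pos_of_mul_pos_right i4 (by positivity)
  have hinv : (G' ∘L .inr ℝ E (ℝ × ℝ)).IsInvertible := by
    have hinj : Function.Injective (G' ∘L .inr ℝ E (ℝ × ℝ)).toLinearMap := by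
      rw [← LinearMap.ker_eq_bot, LinearMap.ker_eq_bot']
      rintro ⟨h, k⟩ hhk
      have e0 : ((0, (h, k)) : E × (ℝ × ℝ)) = h • (0, (1, 0)) + k • (0, (0, 1)) := by simp
      have e1 : G' (0, (h, k)) = 0 := hhk
      rw [e0, map_add, map_smul, map_smul, g1, g2] at e1
      have e2 : h * (1 - a) + k * b = 0 := congrArg Prod.fst e1
      have e3 : h * c + k * (1 - e) = 0 := congrArg Prod.snd e1
      have e4 : h * ((1 - a) * (1 - e) - b * c) = 0 := by linear_combination (1 - e) * e2 - b * e3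
      have e5 : k * ((1 - a) * (1 - e) - b * c) = 0 := by linear_combination (1 - a) * e3 - c * e2
      rw [(mul_eq_zero.1 e4).resolve_right hdet.ne', (mul_eq_zero.1 e5).resolve_right hdet.ne']
      rfl
    exact ⟨(LinearEquiv.ofInjectiveEndo _ hinj).toContinuousLinearEquiv, by ext <;> rfl⟩
  refine ⟨dG.implicitFunctionOfProdDomain hinv,
    (dG.hasStrictFDerivAt_implicitFunctionOfProdDomain hinv).hasFDerivAt.differentiableAt,
    (dG.eventually_apply_eq_iff_implicitFunctionOfProdDomain hinv).self_of_nhds.1 rfl, ?_⟩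
  filter_upwards [dG.eventually_apply_implicitFunctionOfProdDomain hinv] with Z hZ
  rw [hG0] at hZ
  exact ⟨sub_eq_zero.1 (congrArg Prod.fst hZ), sub_eq_zero.1 (congrArg Prod.snd hZ)⟩

end Smooth

/-! ### Calculus of conjugate Wirtinger derivatives. -/

section Wirtinger

attribute [local instance] Matrix.linftyOpNormedAddCommGroup Matrix.linftyOpNormedSpace
  Matrix.linftyOpNormedRing Matrix.linftyOpNormedAlgebra

variable {N M p q : ℕ}

theorem contDiff_matrix_det : ContDiff ℝ 1 (fun A : Matrix (Fin p) (Fin p) ℂ => A.det) := by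
  simp only [det_apply]
  refine ContDiff.sum fun σ _ => ContDiff.const_smul _ (contDiff_prod fun m _ => ?_)
  exact ((entryCLM (σ m) m).restrictScalars ℝ).contDiff

/-- Jacobi's formula at an invertible matrix. -/
theorem HasDerivAt.matrix_det {A : ℝ → Matrix (Fin p) (Fin p) ℂ} {A' : Matrix (Fin p) (Fin p) ℂ}
    {x : ℝ} (h : HasDerivAt A A' x) (hu : IsUnit (A x)) :
    HasDerivAt (fun r => (A r).det) ((A x).det * ((A x)⁻¹ * A').trace) x := by
  have hd := (isUnit_iff_isUnit_det _).1 hu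
  have hf := (contDiff_matrix_det.differentiable one_ne_zero (A x)).hasFDerivAt
  refine (hf.comp_hasDerivAt x h).congr_deriv ?_
  -- The determinant is differentiable, so its derivative in direction `A'` may be computed along
  -- this line, where `det (1 + r N)` is `1 + r tr N` plus a multiple of `r²`.
  have l : HasDerivAt (fun r : ℝ => A x + r • A') A' 0 := by
    exact (((hasDerivAt_id' (0 : ℝ)).smul_const A').const_add (A x)).congr_deriv (one_smul _ _)
  have hf0 : HasFDerivAt (fun A : Matrix (Fin p) (Fin p) ℂ => A.det)
      (fderiv ℝ (fun A : Matrix (Fin p) (Fin p) ℂ => A.det) (A x)) (A x + (0 : ℝ) • A') := by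
    rwa [zero_smul, add_zero]
  have k1 := hf0.comp_hasDerivAt (0 : ℝ) l
  refine k1.unique ?_
  have e : (fun r : ℝ => (A x + r • A').det) = fun r : ℝ => (A x).det *
      (1 + ((A x)⁻¹ * A').trace * (r : ℂ) + Polynomial.eval (r : ℂ)
        (1 + (Polynomial.X : Polynomial ℂ) • ((A x)⁻¹ * A').map Polynomial.C).det.divX.divX *
          (r : ℂ) ^ 2) := by
    funext r
    rw [← det_one_add_smul, ← det_mul, mul_add, mul_one, mul_smul_comm, ← mul_assoc,
      mul_nonsing_inv _ hd, one_mul, Complex.coe_smul]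
  change HasDerivAt (fun r : ℝ => (A x + r • A').det) _ 0
  rw [e]
  refine HasDerivAt.const_mul _ ?_
  generalize (1 + (Polynomial.X : Polynomial ℂ) • ((A x)⁻¹ * A').map Polynomial.C).det.divX.divX
    = P
  have k2 : HasDerivAt (fun z : ℂ => 1 + ((A x)⁻¹ * A').trace * z + P.eval z * z ^ 2)
      ((A x)⁻¹ * A').trace ((0 : ℝ) : ℂ) := by
    have := (((hasDerivAt_id' ((0 : ℝ) : ℂ)).const_mul ((A x)⁻¹ * A').trace).const_add 1).add
      ((P.hasDerivAt ((0 : ℝ) : ℂ)).mul (hasDerivAt_pow 2 ((0 : ℝ) : ℂ)))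
    exact this.congr_deriv (by simp)
  exact k2.comp_ofReal

variable {E E' : Type*} [NormedAddCommGroup E] [NormedSpace ℝ E] [NormedSpace ℂ E]
  [NormedAddCommGroup E'] [NormedSpace ℝ E'] [NormedSpace ℂ E']

/-- `f` has conjugate Wirtinger derivative `w` at `X` with respect to the `(i,j)` entry. -/
def HasConjDeriv (f : Matrix (Fin N) (Fin M) ℂ → E) (w : E) (X : Matrix (Fin N) (Fin M) ℂ)
    (i : Fin N) (j : Fin M) : Prop :=
  ∃ a b : E, HasDerivAt (fun s : ℝ => f (X + Matrix.single i j (s : ℂ))) a 0 ∧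
    HasDerivAt (fun s : ℝ => f (X + Matrix.single i j ((s : ℂ) * Complex.I))) b 0 ∧
    w = (1 / 2 : ℂ) • (a + Complex.I • b)

theorem hasDerivAt_add_single (X : Matrix (Fin N) (Fin M) ℂ) (i : Fin N) (j : Fin M) (c : ℂ) :
    HasDerivAt (fun s : ℝ => X + Matrix.single i j ((s : ℂ) * c)) (Matrix.single i j c) 0 := by
  have h := ((hasDerivAt_id' (0 : ℝ)).smul_const (Matrix.single i j c)).const_add X
  have e : (fun s : ℝ => X + Matrix.single i j ((s : ℂ) * c)) =
      fun s : ℝ => X + s • Matrix.single i j c := by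
    funext s; rw [smul_single, Complex.real_smul]
  rw [e]
  exact h.congr_deriv (one_smul _ _)

theorem hasDerivAt_add_single_one (X : Matrix (Fin N) (Fin M) ℂ) (i : Fin N) (j : Fin M) :
    HasDerivAt (fun s : ℝ => X + Matrix.single i j (s : ℂ)) (Matrix.single i j 1) 0 := by
  simpa using hasDerivAt_add_single X i j 1

theorem tendsto_add_single (X : Matrix (Fin N) (Fin M) ℂ) (i : Fin N) (j : Fin M) :
    Tendsto (fun s : ℝ => X + Matrix.single i j (s : ℂ)) (𝓝 0) (𝓝 X) := by
  simpa using! (hasDerivAt_add_single_one X i j).continuousAt.tendsto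

theorem tendsto_add_single_I (X : Matrix (Fin N) (Fin M) ℂ) (i : Fin N) (j : Fin M) :
    Tendsto (fun s : ℝ => X + Matrix.single i j ((s : ℂ) * Complex.I)) (𝓝 0) (𝓝 X) := by
  simpa using! (hasDerivAt_add_single X i j Complex.I).continuousAt.tendsto

variable {X : Matrix (Fin N) (Fin M) ℂ} {i : Fin N} {j : Fin M}

theorem HasConjDeriv.congr {f g : Matrix (Fin N) (Fin M) ℂ → E} {w : E}
    (h : HasConjDeriv f w X i j) (hfg : g =ᶠ[𝓝 X] f) : HasConjDeriv g w X i j := by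
  obtain ⟨a, b, ha, hb, hw⟩ := h
  exact ⟨a, b, ha.congr_of_eventuallyEq ((tendsto_add_single X i j).eventually hfg),
    hb.congr_of_eventuallyEq ((tendsto_add_single_I X i j).eventually hfg), hw⟩

theorem HasConjDeriv.wirtingerConj_eq {f : Matrix (Fin N) (Fin M) ℂ → ℂ} {w : ℂ}
    (h : HasConjDeriv f w X i j) : wirtingerConj f X i j = w := by
  obtain ⟨a, b, ha, hb, hw⟩ := h
  rw [wirtingerConj, ha.deriv, hb.deriv, hw, smul_eq_mul, smul_eq_mul]

theorem DifferentiableAt.exists_hasConjDeriv {f : Matrix (Fin N) (Fin M) ℂ → E}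
    (h : DifferentiableAt ℝ f X) (i : Fin N) (j : Fin M) : ∃ w, HasConjDeriv f w X i j := by
  have h1 : HasFDerivAt f (fderiv ℝ f X) (X + Matrix.single i j ((0 : ℝ) : ℂ)) := by
    simpa using h.hasFDerivAt
  have h2 : HasFDerivAt f (fderiv ℝ f X) (X + Matrix.single i j (((0 : ℝ) : ℂ) * Complex.I)) := by
    simpa using h.hasFDerivAt
  exact ⟨_, _, _, h1.comp_hasDerivAt _ (hasDerivAt_add_single_one X i j),
    h2.comp_hasDerivAt _ (hasDerivAt_add_single X i j Complex.I), rfl⟩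

/-- Real differentiability ensures that the two `deriv`s in `wirtingerConj` are genuine and not the
default value 0. -/
theorem DifferentiableAt.hasConjDeriv {f : Matrix (Fin N) (Fin M) ℂ → ℂ}
    (h : DifferentiableAt ℝ f X) (i : Fin N) (j : Fin M) :
    HasConjDeriv f (wirtingerConj f X i j) X i j := by
  obtain ⟨w, hw⟩ := h.exists_hasConjDeriv i j
  rwa [hw.wirtingerConj_eq]

theorem hasConjDeriv_const (c : E) : HasConjDeriv (fun _ => c) 0 X i j :=
  ⟨0, 0, hasDerivAt_const _ _, hasDerivAt_const _ _, by simp⟩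

theorem HasConjDeriv.add {f g : Matrix (Fin N) (Fin M) ℂ → E} {w v : E}
    (hf : HasConjDeriv f w X i j) (hg : HasConjDeriv g v X i j) :
    HasConjDeriv (fun Y => f Y + g Y) (w + v) X i j := by
  obtain ⟨a, b, ha, hb, hw⟩ := hf
  obtain ⟨a', b', ha', hb', hw'⟩ := hg
  exact ⟨_, _, ha.add ha', hb.add hb', by rw [hw, hw']; module⟩

theorem HasConjDeriv.const_add {f : Matrix (Fin N) (Fin M) ℂ → E} {w : E} (c : E)
    (hf : HasConjDeriv f w X i j) : HasConjDeriv (fun Y => c + f Y) w X i j := by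
  simpa using (hasConjDeriv_const c).add hf

theorem HasConjDeriv.sum {ι : Type*} {s : Finset ι} {f : ι → Matrix (Fin N) (Fin M) ℂ → E}
    {w : ι → E} (h : ∀ k ∈ s, HasConjDeriv (f k) (w k) X i j) :
    HasConjDeriv (fun Y => ∑ k ∈ s, f k Y) (∑ k ∈ s, w k) X i j := by
  classical
  induction s using Finset.induction_on with
  | empty => simpa using hasConjDeriv_const (0 : E)
  | insert k s hk ih =>
    simp only [Finset.sum_insert hk]
    exact (h k (Finset.mem_insert_self _ _)).add
      (ih fun l hl => h l (Finset.mem_insert_of_mem hl))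

variable [IsScalarTower ℝ ℂ E] [IsScalarTower ℝ ℂ E']

/-- Complex linearity is essential, since `L` has to commute with the factor `I`. The conjugate
transpose therefore needs its own lemma. -/
theorem HasConjDeriv.clm_apply (L : E →L[ℂ] E') {f : Matrix (Fin N) (Fin M) ℂ → E} {w : E}
    (hf : HasConjDeriv f w X i j) : HasConjDeriv (fun Y => L (f Y)) (L w) X i j := by
  obtain ⟨a, b, ha, hb, hw⟩ := hf
  exact ⟨_, _, (L.restrictScalars ℝ).hasFDerivAt.comp_hasDerivAt _ ha,
    (L.restrictScalars ℝ).hasFDerivAt.comp_hasDerivAt _ hb, by rw [hw]; simp⟩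

theorem HasConjDeriv.const_smul (c : ℂ) {f : Matrix (Fin N) (Fin M) ℂ → E} {w : E}
    (hf : HasConjDeriv f w X i j) : HasConjDeriv (fun Y => c • f Y) (c • w) X i j :=
  hf.clm_apply (c • ContinuousLinearMap.id ℂ E)

theorem HasConjDeriv.neg {f : Matrix (Fin N) (Fin M) ℂ → E} {w : E}
    (hf : HasConjDeriv f w X i j) : HasConjDeriv (fun Y => -f Y) (-w) X i j :=
  hf.clm_apply (-ContinuousLinearMap.id ℂ E)

theorem HasConjDeriv.smul {c : Matrix (Fin N) (Fin M) ℂ → ℂ}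
    {f : Matrix (Fin N) (Fin M) ℂ → E} {v : ℂ} {w : E} (hc : HasConjDeriv c v X i j)
    (hf : HasConjDeriv f w X i j) :
    HasConjDeriv (fun Y => c Y • f Y) (c X • w + v • f X) X i j := by
  obtain ⟨a, b, ha, hb, hw⟩ := hf
  obtain ⟨a', b', ha', hb', hw'⟩ := hc
  refine ⟨_, _, ha'.smul ha, hb'.smul hb, ?_⟩
  simp only [hw, hw', smul_eq_mul, Complex.ofReal_zero, zero_mul, single_zero, add_zero]
  module

theorem HasConjDeriv.mul {f g : Matrix (Fin N) (Fin M) ℂ → Matrix (Fin p) (Fin p) ℂ}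
    {w v : Matrix (Fin p) (Fin p) ℂ} (hf : HasConjDeriv f w X i j) (hg : HasConjDeriv g v X i j) :
    HasConjDeriv (fun Y => f Y * g Y) (w * g X + f X * v) X i j := by
  obtain ⟨a, b, ha, hb, hw⟩ := hf
  obtain ⟨a', b', ha', hb', hw'⟩ := hg
  refine ⟨_, _, ha.mul ha', hb.mul hb', ?_⟩
  simp only [hw, hw', Complex.ofReal_zero, zero_mul, single_zero, add_zero, smul_mul_assoc,
    mul_smul_comm, add_mul, mul_add]
  module

theorem HasConjDeriv.entry {f : Matrix (Fin N) (Fin M) ℂ → Matrix (Fin p) (Fin q) ℂ}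
    {w : Matrix (Fin p) (Fin q) ℂ} (h : HasConjDeriv f w X i j) (a : Fin p) (b : Fin q) :
    HasConjDeriv (fun Y => f Y a b) (w a b) X i j :=
  h.clm_apply (entryCLM a b)

theorem HasConjDeriv.of_entry {f : Matrix (Fin N) (Fin M) ℂ → Matrix (Fin p) (Fin q) ℂ}
    {w : Matrix (Fin p) (Fin q) ℂ}
    (h : ∀ a b, HasConjDeriv (fun Y => f Y a b) (w a b) X i j) : HasConjDeriv f w X i j := by
  have e : ∀ A : Matrix (Fin p) (Fin q) ℂ, A = ∑ a, ∑ b, A a b • Matrix.single a b (1 : ℂ) := by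
    intro A
    simpa using matrix_eq_sum_single A
  rw [e w, show f = fun Y => ∑ a, ∑ b, f Y a b • Matrix.single a b (1 : ℂ) from
    funext fun Y => e (f Y)]
  refine HasConjDeriv.sum fun a _ => HasConjDeriv.sum fun b _ => ?_
  simpa using (h a b).smul (hasConjDeriv_const (Matrix.single a b (1 : ℂ)))

theorem HasConjDeriv.wirtingerConjMat_eq
    {f : Matrix (Fin N) (Fin M) ℂ → Matrix (Fin p) (Fin q) ℂ} {w : Matrix (Fin p) (Fin q) ℂ}
    (h : HasConjDeriv f w X i j) : wirtingerConjMat f X i j = w := by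
  ext a b
  exact (h.entry a b).wirtingerConj_eq

theorem DifferentiableAt.hasConjDeriv_mat
    {f : Matrix (Fin N) (Fin M) ℂ → Matrix (Fin p) (Fin q) ℂ}
    (h : DifferentiableAt ℝ f X) (i : Fin N) (j : Fin M) :
    HasConjDeriv f (wirtingerConjMat f X i j) X i j := by
  obtain ⟨w, hw⟩ := h.exists_hasConjDeriv i j
  rwa [hw.wirtingerConjMat_eq]

theorem HasConjDeriv.trace {f : Matrix (Fin N) (Fin M) ℂ → Matrix (Fin p) (Fin p) ℂ}
    {w : Matrix (Fin p) (Fin p) ℂ} (h : HasConjDeriv f w X i j) :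
    HasConjDeriv (fun Y => (f Y).trace) w.trace X i j :=
  h.clm_apply (LinearMap.toContinuousLinearMap (traceLinearMap (Fin p) ℂ ℂ))

theorem HasConjDeriv.matrix_inv {f : Matrix (Fin N) (Fin M) ℂ → Matrix (Fin p) (Fin p) ℂ}
    {w : Matrix (Fin p) (Fin p) ℂ} (h : HasConjDeriv f w X i j) (hu : IsUnit (f X)) :
    HasConjDeriv (fun Y => (f Y)⁻¹) (-((f X)⁻¹ * w * (f X)⁻¹)) X i j := by
  obtain ⟨a, b, ha, hb, hw⟩ := h
  refine ⟨_, _, ha.matrix_inv (by simpa using hu), hb.matrix_inv (by simpa using hu), ?_⟩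
  simp only [hw, Complex.ofReal_zero, zero_mul, single_zero, add_zero, smul_mul_assoc,
    mul_smul_comm, add_mul, mul_add]
  module

theorem HasConjDeriv.log_det {f : Matrix (Fin N) (Fin M) ℂ → Matrix (Fin p) (Fin p) ℂ}
    {w : Matrix (Fin p) (Fin p) ℂ} (h : HasConjDeriv f w X i j)
    (hpos : ∀ᶠ Y in 𝓝 X, 0 < (f Y).det) :
    HasConjDeriv (fun Y => ((Real.log (f Y).det.re : ℝ) : ℂ)) ((f X)⁻¹ * w).trace X i j := by
  have hX := hpos.self_of_nhds
  have hu : IsUnit (f X) := (isUnit_iff_isUnit_det _).2 hX.ne'.isUnit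
  have hslit : (f X).det ∈ Complex.slitPlane := Or.inl (Complex.lt_def.1 hX).1
  -- The holomorphic logarithm obeys the chain rule for conjugate derivatives; near `X` the
  -- determinant is a positive real, so it agrees there with the real logarithm.
  have main : HasConjDeriv (fun Y => Complex.log (f Y).det) ((f X)⁻¹ * w).trace X i j := by
    obtain ⟨a, b, ha, hb, hw⟩ := h
    refine ⟨_, _, (ha.matrix_det (by simpa using hu)).clog_real (by simpa using hslit),
      (hb.matrix_det (by simpa using hu)).clog_real (by simpa using hslit), ?_⟩
    simp only [Complex.ofReal_zero, zero_mul, single_zero, add_zero]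
    rw [mul_div_cancel_left₀ _ hX.ne', mul_div_cancel_left₀ _ hX.ne', hw]
    simp only [mul_smul_comm, mul_add, trace_smul, trace_add]
  refine main.congr ?_
  filter_upwards [hpos] with Y hY
  have h1 := Complex.lt_def.1 hY
  rw [Complex.ofReal_log h1.1.le]
  congr 1
  exact Complex.ext rfl h1.2

/-- `1 + I * I = 0`: holomorphic dependence is invisible to the conjugate derivative. -/
theorem hasConjDeriv_id : HasConjDeriv (fun Y => Y) 0 X i j := by
  refine ⟨_, _, hasDerivAt_add_single_one X i j, hasDerivAt_add_single X i j Complex.I, ?_⟩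
  rw [smul_single, smul_eq_mul, Complex.I_mul_I, ← single_add, add_neg_cancel, single_zero,
    smul_zero]

theorem hasConjDeriv_conjTranspose :
    HasConjDeriv (fun Y => Yᴴ) (Matrix.single j i (1 : ℂ)) X i j := by
  refine ⟨_, _, (conjTransposeCLM N M).hasFDerivAt.comp_hasDerivAt _
    (hasDerivAt_add_single_one X i j), (conjTransposeCLM N M).hasFDerivAt.comp_hasDerivAt _
    (hasDerivAt_add_single X i j Complex.I), ?_⟩
  change _ = (1 / 2 : ℂ) • ((Matrix.single i j 1)ᴴ + Complex.I • (Matrix.single i j Complex.I)ᴴ)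
  rw [conjTranspose_single, conjTranspose_single, smul_single, ← single_add, smul_single]
  congr 1
  simp [one_add_one_eq_two]

end Wirtinger

/-! ### The channel quantities expressed through `covar` and `normTrace`. -/

namespace EveChannel

attribute [local instance] Matrix.linftyOpNormedAddCommGroup Matrix.linftyOpNormedSpace
  Matrix.linftyOpNormedRing Matrix.linftyOpNormedAlgebra

variable {N M : ℕ} (S : EveChannel N M)

/-- The diagonal entries of `S.D`. -/
def gain (m : Fin M) : ℝ := (M : ℝ) * S.beta m / (S.K m + 1)

/-- The squared norms of the columns of a precoder. -/
def colNormSq (F : Matrix (Fin N) (Fin M) ℂ) (n : Fin M) : ℝ := ∑ k, ‖F k n‖ ^ 2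

theorem gain_pos (m : Fin M) : 0 < S.gain m := by
  have h1 := S.K_nonneg m
  have h2 := S.beta_pos m
  have h3 : (0 : ℝ) < M := by exact_mod_cast m.pos
  unfold gain; positivity

theorem colNormSq_nonneg (F : Matrix (Fin N) (Fin M) ℂ) (n : Fin M) : 0 ≤ colNormSq F n :=
  Finset.sum_nonneg fun _ _ => by positivity

theorem exists_colNormSq_pos {F : Matrix (Fin N) (Fin M) ℂ} (hF : F ≠ 0) :
    ∃ n, 0 < colNormSq F n := by
  by_contra! h
  refine hF (Matrix.ext fun k n => ?_)
  have h1 : ∑ k, ‖F k n‖ ^ 2 = 0 := le_antisymm (h n) (colNormSq_nonneg F n)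
  rw [Finset.sum_eq_zero_iff_of_nonneg fun _ _ => by positivity] at h1
  simpa using h1 k (Finset.mem_univ _)

theorem exists_gain_pos {F : Matrix (Fin N) (Fin M) ℂ} (hF : F ≠ 0) : ∃ m, 0 < S.gain m := by
  obtain ⟨n, -⟩ := exists_colNormSq_pos hF
  exact ⟨n, S.gain_pos n⟩

theorem D_eq : S.D = diagonal fun m => (S.gain m : ℂ) := rfl

theorem Dt_eq (F : Matrix (Fin N) (Fin M) ℂ) : Dt F = diagonal fun n => (colNormSq F n : ℂ) := rfl

theorem one_add_smul_diagonal (v : Fin M → ℝ) (x : ℝ) :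
    1 + (x : ℂ) • (diagonal fun n => (v n : ℂ)) = diagonal fun n => ((1 + x * v n : ℝ) : ℂ) := by
  rw [← diagonal_one, ← diagonal_smul, diagonal_add]
  congr 1; ext n; simp

theorem posDef_one_add_smul_diagonal {v : Fin M → ℝ} (hv : ∀ n, 0 ≤ v n) {x : ℝ} (hx : 0 ≤ x) :
    (1 + (x : ℂ) • (diagonal fun n => (v n : ℂ))).PosDef := by
  rw [one_add_smul_diagonal]
  exact posDef_diagonal_ofReal fun n => by have := mul_nonneg hx (hv n); positivity

theorem inv_one_add_smul_diagonal {v : Fin M → ℝ} (hv : ∀ n, 0 ≤ v n) {x : ℝ} (hx : 0 ≤ x) :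
    (1 + (x : ℂ) • (diagonal fun n => (v n : ℂ)))⁻¹ =
      diagonal fun n => (((1 + x * v n)⁻¹ : ℝ) : ℂ) := by
  rw [one_add_smul_diagonal]
  refine Matrix.inv_eq_right_inv ?_
  rw [diagonal_mul_diagonal, ← diagonal_one]
  congr 1; ext n
  have : 1 + x * v n ≠ 0 := by have := mul_nonneg hx (hv n); positivity
  rw [← Complex.ofReal_mul, mul_inv_cancel₀ this, Complex.ofReal_one]

theorem posDef_one_add_D {y : ℝ} (hy : 0 ≤ y) : (1 + (y : ℂ) • S.D).PosDef :=
  posDef_one_add_smul_diagonal (fun m => (S.gain_pos m).le) hy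

theorem posDef_one_add_Dt (F : Matrix (Fin N) (Fin M) ℂ) {x : ℝ} (hx : 0 ≤ x) :
    (1 + (x : ℂ) • Dt F).PosDef :=
  posDef_one_add_smul_diagonal (colNormSq_nonneg F) hx

theorem inv_PhiAt {y : ℝ} (hy : 0 ≤ y) : (S.PhiAt y)⁻¹ = 1 + (y : ℂ) • S.D :=
  nonsing_inv_nonsing_inv _ ((isUnit_iff_isUnit_det _).1 (S.posDef_one_add_D hy).isUnit)

theorem inv_PhitAt (F : Matrix (Fin N) (Fin M) ℂ) {x : ℝ} (hx : 0 ≤ x) :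
    (PhitAt F x)⁻¹ = 1 + (x : ℂ) • Dt F :=
  nonsing_inv_nonsing_inv _ ((isUnit_iff_isUnit_det _).1 (posDef_one_add_Dt F hx).isUnit)

theorem smul_one_add_smul_diagonal (σ : ℝ) (v : Fin M → ℝ) (x : ℝ) :
    (σ : ℂ) ^ 2 • (1 + (x : ℂ) • (diagonal fun n => (v n : ℂ))) =
      diagonal fun n => ((σ ^ 2 * (1 + x * v n) : ℝ) : ℂ) := by
  rw [one_add_smul_diagonal, ← diagonal_smul]
  congr 1; ext n; simp

variable (F : Matrix (Fin N) (Fin M) ℂ) {x y : ℝ}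

theorem GammaAt_eq (hx : 0 ≤ x) (hy : 0 ≤ y) :
    S.GammaAt F x y = (covar (S.sigma ^ 2) S.gain (colNormSq F) (S.B F) x y)⁻¹ := by
  rw [GammaAt, S.inv_PhiAt hy, D_eq, smul_one_add_smul_diagonal, PhitAt, Dt_eq,
    inv_one_add_smul_diagonal (colNormSq_nonneg F) hx, covar]

theorem GammatAt_eq (hx : 0 ≤ x) (hy : 0 ≤ y) :
    S.GammatAt F x y = (covar (S.sigma ^ 2) (colNormSq F) S.gain (S.B F)ᴴ y x)⁻¹ := by
  rw [GammatAt, inv_PhitAt F hx, Dt_eq, smul_one_add_smul_diagonal, PhiAt, D_eq,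
    inv_one_add_smul_diagonal (fun m => (S.gain_pos m).le) hy, covar, conjTranspose_conjTranspose]

theorem sigma_sq_pos : 0 < S.sigma ^ 2 := pow_pos S.sigma_pos 2

theorem trace_diagonal_mul_covar_inv {s : ℝ} {d t : Fin M → ℝ} {B : Matrix (Fin M) (Fin M) ℂ}
    (hs : 0 < s) (hd : ∀ m, 0 ≤ d m) (ht : ∀ m, 0 ≤ t m) (hx : 0 ≤ x) (hy : 0 ≤ y) :
    1 / (M : ℂ) * ((diagonal fun m => (d m : ℂ)) * (covar s d t B x y)⁻¹).trace =
      (normTrace s d t B x y : ℂ) := by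
  have hH := (covar_posDef (B := B) hs hd ht hx hy).inv.isHermitian
  rw [normTrace, Complex.ofReal_mul, Complex.ofReal_sum, Matrix.trace]
  simp only [diag_apply, diagonal_mul]
  push_cast
  congr 1
  refine Finset.sum_congr rfl fun m _ => ?_
  congr 1
  -- Diagonal entries of a Hermitian matrix are real, so taking real parts in `normTrace` loses
  -- nothing.
  exact (Complex.conj_eq_iff_re.1 (hH.apply m m)).symm

theorem isPosSol_iff : S.IsPosSol F (x, y) ↔ 0 < x ∧ 0 < y ∧
    x = normTrace (S.sigma ^ 2) S.gain (colNormSq F) (S.B F) x y ∧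
    y = normTrace (S.sigma ^ 2) (colNormSq F) S.gain (S.B F)ᴴ y x := by
  refine and_congr_right fun hx => and_congr_right fun hy => ?_
  have hd : ∀ m, 0 ≤ S.gain m := fun m => (S.gain_pos m).le
  dsimp only at hx hy ⊢
  rw [S.GammaAt_eq F hx.le hy.le, S.GammatAt_eq F hx.le hy.le, D_eq, Dt_eq,
    trace_diagonal_mul_covar_inv S.sigma_sq_pos hd (colNormSq_nonneg F) hx.le hy.le,
    trace_diagonal_mul_covar_inv S.sigma_sq_pos (colNormSq_nonneg F) hd hy.le hx.le,
    Complex.ofReal_inj, Complex.ofReal_inj]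

/-! ### Unique solvability and differentiability in the precoder. -/

variable {F}

theorem existsUnique_isPosSol (hF : F ≠ 0) : ∃! p : ℝ × ℝ, S.IsPosSol F p := by
  have hd : ∀ m, 0 ≤ S.gain m := fun m => (S.gain_pos m).le
  obtain ⟨x, y, h⟩ := exists_normTrace_fixedPoint (B := S.B F) S.sigma_sq_pos hd
    (S.exists_gain_pos hF) (colNormSq_nonneg F) (exists_colNormSq_pos hF)
  refine ⟨(x, y), (S.isPosSol_iff F).2 h, ?_⟩
  rintro ⟨x', y'⟩ h'
  obtain ⟨h1, h2, h3, h4⟩ := (S.isPosSol_iff F).1 h'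
  have := normTrace_fixedPoint_unique S.sigma_sq_pos hd (S.exists_gain_pos hF)
    (colNormSq_nonneg F) (exists_colNormSq_pos hF) h1 h2 h.1 h.2.1 h3 h4 h.2.2.1 h.2.2.2
  exact Prod.ext this.1 this.2

theorem isPosSol_sol (hF : F ≠ 0) : S.IsPosSol F (S.sol F) := by
  have h := (S.existsUnique_isPosSol hF).exists
  rw [sol, dif_pos h]
  exact h.choose_spec

theorem delta_pos (hF : F ≠ 0) : 0 < S.delta F := (S.isPosSol_sol hF).1

theorem deltat_pos (hF : F ≠ 0) : 0 < S.deltat F := (S.isPosSol_sol hF).2.1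

theorem contDiff_colNormSq : ContDiff ℝ 1 (colNormSq : Matrix (Fin N) (Fin M) ℂ → Fin M → ℝ) := by
  refine contDiff_pi.2 fun n => ContDiff.sum fun k _ => ContDiff.norm_sq ℝ ?_
  exact ((entryCLM k n).restrictScalars ℝ).contDiff

/-- `S.B` as a continuous linear map. -/
def BCLM : Matrix (Fin N) (Fin M) ℂ →L[ℂ] Matrix (Fin M) (Fin M) ℂ :=
  LinearMap.toContinuousLinearMap
    { toFun := S.B
      map_add' := fun F G => Matrix.mul_add _ F G
      map_smul' := fun c F => Matrix.mul_smul _ c F }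

theorem contDiff_B : ContDiff ℝ 1 S.B := (S.BCLM.restrictScalars ℝ).contDiff

theorem eventually_ne_zero (hF : F ≠ 0) : ∀ᶠ Y in 𝓝 F, Y ≠ 0 := isOpen_ne.mem_nhds hF

theorem differentiableAt_sol (hF : F ≠ 0) : DifferentiableAt ℝ S.sol F := by
  obtain ⟨h1, h2, h3, h4⟩ := (S.isPosSol_iff F).1 (S.isPosSol_sol hF)
  obtain ⟨φ, hφ, hφF, hsol⟩ := exists_differentiableAt_fixedPoint
    contDiff_colNormSq.contDiffAt S.contDiff_B.contDiffAt S.sigma_sq_pos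
    (fun m => (S.gain_pos m).le) (S.exists_gain_pos hF) (colNormSq_nonneg F)
    (exists_colNormSq_pos hF) h1 h2 h3 h4
  -- Near `F` the implicit solution stays positive and the precoder stays nonzero, so uniqueness
  -- identifies it with the chosen `S.sol`.
  refine hφ.congr_of_eventuallyEq ?_
  have c1 : ∀ᶠ Z in 𝓝 F, 0 < (φ Z).1 :=
    (continuous_fst.continuousAt.comp hφ.continuousAt).eventually
      (lt_mem_nhds (by simpa [hφF] using h1))
  have c2 : ∀ᶠ Z in 𝓝 F, 0 < (φ Z).2 :=
    (continuous_snd.continuousAt.comp hφ.continuousAt).eventually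
      (lt_mem_nhds (by simpa [hφF] using h2))
  filter_upwards [hsol, c1, c2, eventually_ne_zero hF] with Z hZ hZ1 hZ2 hZ0
  exact (S.existsUnique_isPosSol hZ0).unique (S.isPosSol_sol hZ0)
    ((S.isPosSol_iff Z).2 ⟨hZ1, hZ2, hZ.1, hZ.2⟩)

theorem differentiableAt_delta (hF : F ≠ 0) : DifferentiableAt ℝ S.delta F :=
  (S.differentiableAt_sol hF).fst

theorem differentiableAt_deltat (hF : F ≠ 0) : DifferentiableAt ℝ S.deltat F :=
  (S.differentiableAt_sol hF).snd

theorem differentiableAt_ofReal_delta (hF : F ≠ 0) :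
    DifferentiableAt ℝ (fun Y => (S.delta Y : ℂ)) F :=
  Complex.ofRealCLM.differentiableAt.comp F (S.differentiableAt_delta hF)

theorem differentiableAt_ofReal_deltat (hF : F ≠ 0) :
    DifferentiableAt ℝ (fun Y => (S.deltat Y : ℂ)) F :=
  Complex.ofRealCLM.differentiableAt.comp F (S.differentiableAt_deltat hF)

theorem differentiable_Dt :
    Differentiable ℝ (Dt : Matrix (Fin N) (Fin M) ℂ → Matrix (Fin M) (Fin M) ℂ) :=
  (diagonalCLM M).differentiable.comp (contDiff_colNormSq.differentiable one_ne_zero)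

theorem differentiable_B : Differentiable ℝ S.B := S.contDiff_B.differentiable one_ne_zero

theorem differentiable_B_conjTranspose : Differentiable ℝ (fun Y => (S.B Y)ᴴ) :=
  (conjTransposeCLM M M).differentiable.comp S.differentiable_B

theorem differentiableAt_one_add_smul_Dt (hF : F ≠ 0) :
    DifferentiableAt ℝ (fun Y => 1 + (S.delta Y : ℂ) • Dt Y) F :=
  ((S.differentiableAt_ofReal_delta hF).smul (differentiable_Dt F)).const_add 1

theorem differentiableAt_one_add_smul_D (hF : F ≠ 0) :
    DifferentiableAt ℝ (fun Y => 1 + (S.deltat Y : ℂ) • S.D) F :=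
  ((S.differentiableAt_ofReal_deltat hF).smul_const S.D).const_add 1

theorem differentiableAt_matrix_inv {f : Matrix (Fin N) (Fin M) ℂ → Matrix (Fin M) (Fin M) ℂ}
    (hf : DifferentiableAt ℝ f F) (hu : IsUnit (f F)) :
    DifferentiableAt ℝ (fun Y => (f Y)⁻¹) F :=
  ((contDiffAt_matrix_inv hu).differentiableAt one_ne_zero).comp F hf

theorem differentiableAt_Phi (hF : F ≠ 0) : DifferentiableAt ℝ S.Phi F :=
  differentiableAt_matrix_inv (S.differentiableAt_one_add_smul_D hF)
    (S.posDef_one_add_D (S.deltat_pos hF).le).isUnit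

theorem differentiableAt_Phit (hF : F ≠ 0) : DifferentiableAt ℝ S.Phit F :=
  differentiableAt_matrix_inv (S.differentiableAt_one_add_smul_Dt hF)
    (posDef_one_add_Dt F (S.delta_pos hF).le).isUnit

theorem differentiableAt_Xi (hF : F ≠ 0) : DifferentiableAt ℝ S.Xi F :=
  ((S.differentiable_B F).mul (S.differentiableAt_Phit hF)).mul
    (S.differentiable_B_conjTranspose F)

theorem differentiableAt_Xit (hF : F ≠ 0) : DifferentiableAt ℝ S.Xit F :=
  ((S.differentiable_B_conjTranspose F).mul (S.differentiableAt_Phi hF)).mul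
    (S.differentiable_B F)

theorem Gamma_eq (hF : F ≠ 0) :
    S.Gamma F = ((S.sigma : ℂ) ^ 2 • (1 + (S.deltat F : ℂ) • S.D) + S.Xi F)⁻¹ := by
  rw [Gamma, GammaAt, S.inv_PhiAt (S.deltat_pos hF).le]; rfl

theorem Gammat_eq (hF : F ≠ 0) :
    S.Gammat F = ((S.sigma : ℂ) ^ 2 • (1 + (S.delta F : ℂ) • Dt F) + S.Xit F)⁻¹ := by
  rw [Gammat, GammatAt, inv_PhitAt F (S.delta_pos hF).le]; rfl

theorem posDef_Gamma (hF : F ≠ 0) : (S.Gamma F).PosDef := by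
  rw [Gamma, S.GammaAt_eq F (S.delta_pos hF).le (S.deltat_pos hF).le]
  exact (covar_posDef S.sigma_sq_pos (fun m => (S.gain_pos m).le) (colNormSq_nonneg F)
    (S.delta_pos hF).le (S.deltat_pos hF).le).inv

theorem posDef_Gammat (hF : F ≠ 0) : (S.Gammat F).PosDef := by
  rw [Gammat, S.GammatAt_eq F (S.delta_pos hF).le (S.deltat_pos hF).le]
  exact (covar_posDef S.sigma_sq_pos (colNormSq_nonneg F) (fun m => (S.gain_pos m).le)
    (S.deltat_pos hF).le (S.delta_pos hF).le).inv

/-- A matrix is invertible as soon as its nonsingular inverse is, and that inverse is the positive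
definite `Γ`. -/
theorem isUnit_inv_Gamma (hF : F ≠ 0) :
    IsUnit ((S.sigma : ℂ) ^ 2 • (1 + (S.deltat F : ℂ) • S.D) + S.Xi F) := by
  rw [← isUnit_nonsing_inv_iff, ← S.Gamma_eq hF]
  exact (S.posDef_Gamma hF).isUnit

theorem isUnit_inv_Gammat (hF : F ≠ 0) :
    IsUnit ((S.sigma : ℂ) ^ 2 • (1 + (S.delta F : ℂ) • Dt F) + S.Xit F) := by
  rw [← isUnit_nonsing_inv_iff, ← S.Gammat_eq hF]
  exact (S.posDef_Gammat hF).isUnit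

theorem differentiableAt_Gamma (hF : F ≠ 0) : DifferentiableAt ℝ S.Gamma F := by
  refine (differentiableAt_matrix_inv (((S.differentiableAt_one_add_smul_D hF).const_smul
    ((S.sigma : ℂ) ^ 2)).add (S.differentiableAt_Xi hF))
    (S.isUnit_inv_Gamma hF)).congr_of_eventuallyEq ?_
  filter_upwards [eventually_ne_zero hF] with Y hY using S.Gamma_eq hY

theorem differentiableAt_Gammat (hF : F ≠ 0) : DifferentiableAt ℝ S.Gammat F := by
  refine (differentiableAt_matrix_inv (((S.differentiableAt_one_add_smul_Dt hF).const_smul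
    ((S.sigma : ℂ) ^ 2)).add (S.differentiableAt_Xit hF))
    (S.isUnit_inv_Gammat hF)).congr_of_eventuallyEq ?_
  filter_upwards [eventually_ne_zero hF] with Y hY using S.Gammat_eq hY

theorem det_smul_Gamma_pos (hF : F ≠ 0) : 0 < ((S.sigma : ℂ) ^ 2 • S.Gamma F).det :=
  ((S.posDef_Gamma hF).smul (by exact_mod_cast S.sigma_sq_pos)).det_pos

theorem det_one_add_smul_Dt_pos (hF : F ≠ 0) : 0 < (1 + (S.delta F : ℂ) • Dt F).det :=
  (posDef_one_add_Dt F (S.delta_pos hF).le).det_pos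

theorem differentiableAt_log_det {f : Matrix (Fin N) (Fin M) ℂ → Matrix (Fin M) (Fin M) ℂ}
    (hf : DifferentiableAt ℝ f F) (h : 0 < (f F).det) :
    DifferentiableAt ℝ (fun Y => Real.log (f Y).det.re) F :=
  (Complex.reCLM.differentiableAt.comp F
    ((contDiff_matrix_det.differentiable one_ne_zero (f F)).comp F hf)).log
    (Complex.lt_def.1 h).1.ne'

theorem differentiableAt_rate (hF : F ≠ 0) : DifferentiableAt ℝ S.rate F :=
  ((differentiableAt_log_det ((S.differentiableAt_Gamma hF).const_smul ((S.sigma : ℂ) ^ 2))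
    (S.det_smul_Gamma_pos hF)).neg.add
    (differentiableAt_log_det (S.differentiableAt_one_add_smul_Dt hF)
      (S.det_one_add_smul_Dt_pos hF))).sub
    (((S.differentiableAt_delta hF).const_mul _).mul (S.differentiableAt_deltat hF))

/-! ### Conjugate derivatives of the channel quantities and of the rate. -/

variable (i : Fin N) (j : Fin M)

/-- `B` is complex linear in the precoder, so in `Ξ` and `Ξ̃` only the factor `Bᴴ` and the inner
matrix contribute. -/
theorem hasConjDeriv_B : HasConjDeriv S.B 0 F i j := by
  have h : HasConjDeriv (fun Y => S.BCLM Y) (S.BCLM 0) F i j :=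
    hasConjDeriv_id.clm_apply S.BCLM
  rwa [map_zero] at h

theorem hasConjDeriv_B_conjTranspose :
    HasConjDeriv (fun Y => (S.B Y)ᴴ) (Matrix.single j i (1 : ℂ) * S.GLoS * S.sqrtLambda) F i j := by
  let L : Matrix (Fin M) (Fin N) ℂ →L[ℂ] Matrix (Fin M) (Fin M) ℂ :=
    LinearMap.toContinuousLinearMap
      { toFun := fun Y => Y * S.GLoS * S.sqrtLambda
        map_add' := fun F G => by rw [Matrix.add_mul, Matrix.add_mul]
        map_smul' := fun c F => by rw [Matrix.smul_mul, Matrix.smul_mul, RingHom.id_apply] }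
  have h : HasConjDeriv (fun Y => L Yᴴ) (L (Matrix.single j i 1)) F i j :=
    hasConjDeriv_conjTranspose.clm_apply L
  have hΛ : S.sqrtLambdaᴴ = S.sqrtLambda := by
    rw [sqrtLambda, diagonal_conjTranspose]
    congr 1; ext m; simp
  refine h.congr (Eventually.of_forall fun Y => ?_)
  change _ = Yᴴ * S.GLoS * S.sqrtLambda
  simp only [B, conjTranspose_mul, conjTranspose_conjTranspose, hΛ, Matrix.mul_assoc]

theorem hasConjDeriv_Dt :
    HasConjDeriv Dt (diagonal fun n => F i j * (if n = j then 1 else 0)) F i j := by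
  have hcol : ∀ n, HasConjDeriv (fun Y : Matrix (Fin N) (Fin M) ℂ => (colNormSq Y n : ℂ))
      (F i j * (if n = j then 1 else 0)) F i j := by
    intro n
    -- Each `‖z‖²` is treated as `z` times its conjugate; only the conjugate factor has a nonzero
    -- derivative, leaving `z`.
    have h := HasConjDeriv.sum (s := Finset.univ) fun k (_ : k ∈ Finset.univ) =>
      (HasConjDeriv.entry (hasConjDeriv_id (X := F) (i := i) (j := j)) k n).smul
        (HasConjDeriv.entry (hasConjDeriv_conjTranspose (X := F) (i := i) (j := j)) n k)
    have e : ∑ k, (F k n • Matrix.single j i (1 : ℂ) n k +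
        (0 : Matrix (Fin N) (Fin M) ℂ) k n • Fᴴ n k) = F i j * (if n = j then 1 else 0) := by
      rw [Finset.sum_eq_single i]
      · by_cases hn : n = j
        · subst hn; simp
        · simp [hn, Ne.symm hn]
      · intro k _ hk
        simp [Ne.symm hk]
      · simp
    rw [e] at h
    refine h.congr (Eventually.of_forall fun Y => ?_)
    simp only [colNormSq, Complex.ofReal_sum, conjTranspose_apply, smul_eq_mul]
    refine Finset.sum_congr rfl fun k _ => ?_
    rw [Complex.ofReal_pow, ← Complex.mul_conj', Complex.star_def]
  refine HasConjDeriv.of_entry fun a b => ?_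
  by_cases hab : a = b
  · subst hab
    simpa [Dt_eq] using hcol a
  · simpa [Dt_eq, hab] using hasConjDeriv_const (0 : ℂ)

variable {i j}

theorem hasConjDeriv_one_add_smul_D {v : ℂ}
    (h : HasConjDeriv (fun Y => (S.deltat Y : ℂ)) v F i j) :
    HasConjDeriv (fun Y => 1 + (S.deltat Y : ℂ) • S.D) (v • S.D) F i j := by
  simpa using (h.smul (hasConjDeriv_const S.D)).const_add 1

theorem hasConjDeriv_one_add_smul_Dt {v : ℂ}
    (h : HasConjDeriv (fun Y => (S.delta Y : ℂ)) v F i j) :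
    HasConjDeriv (fun Y => 1 + (S.delta Y : ℂ) • Dt Y) ((S.delta F : ℂ) •
      (diagonal fun n => F i j * (if n = j then 1 else 0)) + v • Dt F) F i j :=
  (h.smul (hasConjDeriv_Dt i j)).const_add 1

/-- The fixed-point equation holds at all nonzero precoders, hence in a neighbourhood of `F`, and
may be differentiated. -/
theorem hasConjDeriv_delta (hF : F ≠ 0) {Γ' : Matrix (Fin M) (Fin M) ℂ}
    (h : HasConjDeriv S.Gamma Γ' F i j) :
    HasConjDeriv (fun Y => (S.delta Y : ℂ)) (1 / (M : ℂ) * (S.D * Γ').trace) F i j := by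
  have h1 := (((hasConjDeriv_const S.D).mul h).trace).const_smul (1 / (M : ℂ))
  rw [Matrix.zero_mul, zero_add] at h1
  refine h1.congr ?_
  filter_upwards [eventually_ne_zero hF] with Y hY using (S.isPosSol_sol hY).2.2.1

theorem hasConjDeriv_deltat (hF : F ≠ 0) {Γt' : Matrix (Fin M) (Fin M) ℂ}
    (h : HasConjDeriv S.Gammat Γt' F i j) :
    HasConjDeriv (fun Y => (S.deltat Y : ℂ)) (1 / (M : ℂ) * (Dt F * Γt').trace +
      1 / (M : ℂ) * ((diagonal fun n => F i j * (if n = j then 1 else 0)) *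
        S.Gammat F).trace) F i j := by
  have h1 := (((hasConjDeriv_Dt i j).mul h).trace).const_smul (1 / (M : ℂ))
  rw [trace_add, smul_add, add_comm] at h1
  refine h1.congr ?_
  filter_upwards [eventually_ne_zero hF] with Y hY using (S.isPosSol_sol hY).2.2.2

theorem hasConjDeriv_Xi {Φt' : Matrix (Fin M) (Fin M) ℂ} (h : HasConjDeriv S.Phit Φt' F i j) :
    HasConjDeriv S.Xi (S.B F * S.Phit F * Matrix.single j i (1 : ℂ) * S.GLoS * S.sqrtLambda +
      S.B F * Φt' * (S.B F)ᴴ) F i j := by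
  have h1 := ((S.hasConjDeriv_B i j).mul h).mul (S.hasConjDeriv_B_conjTranspose i j)
  rw [Matrix.zero_mul, zero_add, add_comm, ← Matrix.mul_assoc, ← Matrix.mul_assoc] at h1
  exact h1

theorem hasConjDeriv_Xit {Φ' : Matrix (Fin M) (Fin M) ℂ} (h : HasConjDeriv S.Phi Φ' F i j) :
    HasConjDeriv S.Xit (Matrix.single j i (1 : ℂ) * S.GLoS * S.sqrtLambda * S.Phi F * S.B F +
      (S.B F)ᴴ * Φ' * S.B F) F i j := by
  have h1 := ((S.hasConjDeriv_B_conjTranspose i j).mul h).mul (S.hasConjDeriv_B i j)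
  rw [Matrix.mul_zero, add_zero, Matrix.add_mul] at h1
  exact h1

theorem hasConjDeriv_Phi (hF : F ≠ 0) {v : ℂ}
    (h : HasConjDeriv (fun Y => (S.deltat Y : ℂ)) v F i j) :
    HasConjDeriv S.Phi (-(S.Phi F * (v • S.D) * S.Phi F)) F i j :=
  (S.hasConjDeriv_one_add_smul_D h).matrix_inv (S.posDef_one_add_D (S.deltat_pos hF).le).isUnit

theorem hasConjDeriv_Phit (hF : F ≠ 0) {v : ℂ}
    (h : HasConjDeriv (fun Y => (S.delta Y : ℂ)) v F i j) :
    HasConjDeriv S.Phit (-(S.Phit F * ((S.delta F : ℂ) •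
      (diagonal fun n => F i j * (if n = j then 1 else 0)) + v • Dt F) * S.Phit F)) F i j :=
  (S.hasConjDeriv_one_add_smul_Dt h).matrix_inv (posDef_one_add_Dt F (S.delta_pos hF).le).isUnit

theorem hasConjDeriv_Gamma (hF : F ≠ 0) {v : ℂ} {Ξ' : Matrix (Fin M) (Fin M) ℂ}
    (h : HasConjDeriv (fun Y => (S.deltat Y : ℂ)) v F i j) (hΞ : HasConjDeriv S.Xi Ξ' F i j) :
    HasConjDeriv S.Gamma
      (-(S.Gamma F * (((S.sigma : ℂ) ^ 2 * v) • S.D + Ξ') * S.Gamma F)) F i j := by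
  have h1 := (((S.hasConjDeriv_one_add_smul_D h).const_smul ((S.sigma : ℂ) ^ 2)).add hΞ).matrix_inv
    (S.isUnit_inv_Gamma hF)
  rw [← S.Gamma_eq hF, smul_smul] at h1
  refine h1.congr ?_
  filter_upwards [eventually_ne_zero hF] with Y hY using S.Gamma_eq hY

theorem hasConjDeriv_Gammat (hF : F ≠ 0) {v : ℂ} {Ξt' : Matrix (Fin M) (Fin M) ℂ}
    (h : HasConjDeriv (fun Y => (S.delta Y : ℂ)) v F i j) (hΞ : HasConjDeriv S.Xit Ξt' F i j) :
    HasConjDeriv S.Gammat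
      (-(S.Gammat F * (((S.sigma : ℂ) ^ 2 * S.delta F) •
        (diagonal fun n => F i j * (if n = j then 1 else 0)) +
        ((S.sigma : ℂ) ^ 2 * v) • Dt F + Ξt') * S.Gammat F)) F i j := by
  have h1 := (((S.hasConjDeriv_one_add_smul_Dt h).const_smul ((S.sigma : ℂ) ^ 2)).add hΞ).matrix_inv
    (S.isUnit_inv_Gammat hF)
  rw [← S.Gammat_eq hF, smul_add, smul_smul, smul_smul] at h1
  refine h1.congr ?_
  filter_upwards [eventually_ne_zero hF] with Y hY using S.Gammat_eq hY

theorem hasConjDeriv_rate (hF : F ≠ 0) {v vt : ℂ} {Γ' : Matrix (Fin M) (Fin M) ℂ}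
    (h : HasConjDeriv (fun Y => (S.delta Y : ℂ)) v F i j)
    (ht : HasConjDeriv (fun Y => (S.deltat Y : ℂ)) vt F i j)
    (hΓ : HasConjDeriv S.Gamma Γ' F i j) :
    HasConjDeriv (fun Y => (S.rate Y : ℂ)) (-((S.Gamma F)⁻¹ * Γ').trace +
      (S.Phit F * ((S.delta F : ℂ) • (diagonal fun n => F i j * (if n = j then 1 else 0)) +
        v • Dt F)).trace -
      (S.sigma : ℂ) ^ 2 * (M : ℂ) * (v * S.deltat F + S.delta F * vt)) F i j := by
  have hσ : (S.sigma : ℂ) ^ 2 ≠ 0 := pow_ne_zero 2 (Complex.ofReal_ne_zero.2 S.sigma_pos.ne')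
  -- The noise factor inside the logarithm cancels in the logarithmic derivative.
  have e1 : ((S.sigma : ℂ) ^ 2 • S.Gamma F)⁻¹ * ((S.sigma : ℂ) ^ 2 • Γ') = (S.Gamma F)⁻¹ * Γ' := by
    rw [← Units.smul_mk0 hσ, Matrix.inv_smul' _ _
      ((isUnit_iff_isUnit_det _).1 (S.posDef_Gamma hF).isUnit), ← Units.smul_mk0 hσ,
      Matrix.smul_mul, Matrix.mul_smul, inv_smul_smul]
  have h1 := (hΓ.const_smul ((S.sigma : ℂ) ^ 2)).log_det
    ((eventually_ne_zero hF).mono fun Y hY => S.det_smul_Gamma_pos hY)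
  rw [e1] at h1
  have h2 := (S.hasConjDeriv_one_add_smul_Dt h).log_det
    ((eventually_ne_zero hF).mono fun Y hY => S.det_one_add_smul_Dt_pos hY)
  have h3 := (h.smul ht).const_smul (-((S.sigma : ℂ) ^ 2 * (M : ℂ)))
  have e2 : -((S.sigma : ℂ) ^ 2 * (M : ℂ)) • ((S.delta F : ℂ) • vt + v • (S.deltat F : ℂ)) =
      -((S.sigma : ℂ) ^ 2 * (M : ℂ) * (v * S.deltat F + S.delta F * vt)) := by
    simp only [smul_eq_mul]; ring
  have h4 := (h1.neg.add h2).add h3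
  rw [e2, ← sub_eq_add_neg] at h4
  refine h4.congr (Eventually.of_forall fun Y => ?_)
  simp only [rate, smul_eq_mul]
  push_cast
  ring

end EveChannel

end

theorem proposition2 {N M : ℕ} (S : EveChannel N M) (F : Matrix (Fin N) (Fin M) ℂ) (hF : F ≠ 0) :
    -- `(δ, δ̃)` is the unique positive solution of the fixed-point system
    ((∃! p : ℝ × ℝ, S.IsPosSol F p) ∧ S.IsPosSol F (S.delta F, S.deltat F)) ∧
    -- all quantities are differentiable, in the real sense, with respect to the precoder
    (DifferentiableAt ℝ S.delta F ∧ DifferentiableAt ℝ S.deltat F ∧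
      DifferentiableAt ℝ S.Phi F ∧ DifferentiableAt ℝ S.Phit F ∧
      DifferentiableAt ℝ S.Xi F ∧ DifferentiableAt ℝ S.Xit F ∧
      DifferentiableAt ℝ S.Gamma F ∧ DifferentiableAt ℝ S.Gammat F ∧
      DifferentiableAt ℝ S.rate F) ∧
    ∀ (i : Fin N) (j : Fin M),
      let δ : ℂ := (S.delta F : ℂ)
      let δt : ℂ := (S.deltat F : ℂ)
      let σ : ℂ := (S.sigma : ℂ)
      let B := S.B F
      let D := S.D
      let Dt := EveChannel.Dt F
      let Φ := S.Phi F
      let Φt := S.Phit F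
      let Γ := S.Gamma F
      let Γt := S.Gammat F
      -- the derivatives with respect to the conjugate of the entry `F i j`
      let δ' := wirtingerConj (fun X => (S.delta X : ℂ)) F i j
      let δt' := wirtingerConj (fun X => (S.deltat X : ℂ)) F i j
      let Φ' := wirtingerConjMat S.Phi F i j
      let Φt' := wirtingerConjMat S.Phit F i j
      let Ξ' := wirtingerConjMat S.Xi F i j
      let Ξt' := wirtingerConjMat S.Xit F i j
      let Γ' := wirtingerConjMat S.Gamma F i j
      let Γt' := wirtingerConjMat S.Gammat F i j
      -- `e_j e_iᵀ`
      let E : Matrix (Fin M) (Fin N) ℂ := Matrix.single j i 1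
      -- the diagonal matrix with entries `F i j` times the Kronecker delta of `(n, j)`
      let Dt' : Matrix (Fin M) (Fin M) ℂ :=
        Matrix.diagonal fun n => F i j * (if n = j then 1 else 0)
      wirtingerConjMat EveChannel.Dt F i j = Dt' ∧
      -- the linear fixed-point system
      δ' = 1 / (M : ℂ) * (D * Γ').trace ∧
      δt' = 1 / (M : ℂ) * (Dt * Γt').trace + 1 / (M : ℂ) * (Dt' * Γt).trace ∧
      Ξ' = B * Φt * E * S.GLoS * S.sqrtLambda + B * Φt' * Bᴴ ∧
      Ξt' = E * S.GLoS * S.sqrtLambda * Φ * B + Bᴴ * Φ' * B ∧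
      Γ' = -(Γ * ((σ ^ 2 * δt') • D + Ξ') * Γ) ∧
      Γt' = -(Γt * ((σ ^ 2 * δ) • Dt' + (σ ^ 2 * δ') • Dt + Ξt') * Γt) ∧
      Φ' = -(Φ * (δt' • D) * Φ) ∧
      Φt' = -(Φt * (δ • Dt' + δ' • Dt) * Φt) ∧
      -- the gradient of the rate
      S.rateGradient F i j =
        -(Γ⁻¹ * Γ').trace + (Φt * (δ • Dt' + δ' • Dt)).trace
          - σ ^ 2 * (M : ℂ) * (δ' * δt + δ * δt') := by
  refine ⟨⟨S.existsUnique_isPosSol hF, S.isPosSol_sol hF⟩,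
    ⟨S.differentiableAt_delta hF, S.differentiableAt_deltat hF, S.differentiableAt_Phi hF,
      S.differentiableAt_Phit hF, S.differentiableAt_Xi hF, S.differentiableAt_Xit hF,
      S.differentiableAt_Gamma hF, S.differentiableAt_Gammat hF, S.differentiableAt_rate hF⟩,
    fun i j => ?_⟩
  -- All derivatives exist by differentiability; each formula then follows by uniqueness of the
  -- derivative.
  have hδ := (S.differentiableAt_ofReal_delta hF).hasConjDeriv i j
  have hδt := (S.differentiableAt_ofReal_deltat hF).hasConjDeriv i j
  have hΦ := DifferentiableAt.hasConjDeriv_mat (S.differentiableAt_Phi hF) i j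
  have hΦt := DifferentiableAt.hasConjDeriv_mat (S.differentiableAt_Phit hF) i j
  have hΞ := DifferentiableAt.hasConjDeriv_mat (S.differentiableAt_Xi hF) i j
  have hΞt := DifferentiableAt.hasConjDeriv_mat (S.differentiableAt_Xit hF) i j
  have hΓ := DifferentiableAt.hasConjDeriv_mat (S.differentiableAt_Gamma hF) i j
  have hΓt := DifferentiableAt.hasConjDeriv_mat (S.differentiableAt_Gammat hF) i j
  exact ⟨(EveChannel.hasConjDeriv_Dt i j).wirtingerConjMat_eq,
    (S.hasConjDeriv_delta hF hΓ).wirtingerConj_eq,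
    (S.hasConjDeriv_deltat hF hΓt).wirtingerConj_eq,
    (S.hasConjDeriv_Xi hΦt).wirtingerConjMat_eq,
    (S.hasConjDeriv_Xit hΦ).wirtingerConjMat_eq,
    (S.hasConjDeriv_Gamma hF hδt hΞ).wirtingerConjMat_eq,
    (S.hasConjDeriv_Gammat hF hδ hΞt).wirtingerConjMat_eq,
    (S.hasConjDeriv_Phi hF hδt).wirtingerConjMat_eq,
    (S.hasConjDeriv_Phit hF hδ).wirtingerConjMat_eq,
    (S.hasConjDeriv_rate hF hδ hδt hΓ).wirtingerConj_eq⟩
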